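/- Let positions be the elements of $V=\mathbb{Z}$ or of a cycle $V=\mathbb{Z}_N$ ($N\ge 1$), with $v-1$ the left neighbour of $v$. A state assigns to each position a particle, an anti-particle, or nothing (empty). Two sets $S,T\subseteq V$, not necessarily disjoint, *collapse* to the state $x$ if $x$ results from the following procedure. Anti-particles are placed at all positions of $T$. Then the locations in $S$ are checked, in an arbitrary (well-)order: when $s\in S$ is checked, a particle is placed at the first empty position among $s,s-1,s-2,\dots$; if there is no such position, $s$ is disregarded. Let $S'$ denote the set of positions of the particles of $x$. 1. (Cycle.) Let $N\ge 1$ and $a,b\ge 0$ with $a+b\le N$. Let $S$ and $T$ be independent random subsets of $\mathbb{Z}_N$, with $S$ uniform over the $\binom{N}{a}$ subsets of size $a$ and $T$ uniform over the $\binom{N}{b}$ subsets of size $b$. If $S,T$ almost surely collapse to the random state $x$, then $S'$ is uniform over the $\binom{N}{a}$ subsets of $\mathbb{Z}_N$ of size $a$. 2. (Line.) Let $p,q\in[0,1]$. Let $S$ and $T$ be independent random subsets of $\mathbb{Z}$, where each $n\in\mathbb{Z}$ belongs to $S$ with probability $p$ and to $T$ with probability $q$, all independently. If $S,T$ almost surely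 collapse to the random state $x$, then $S'$ has an i.i.d. product distribution: each $n\in\mathbb{Z}$ belongs to $S'$ with probability $\min(p,1-q)$, independently for different $n$. (That is, the density is $p$ if $p+q\le 1$ and $1-q$ if $p+q\ge 1$.) -/

import Mathlib

open MeasureTheory ProbabilityTheory

/-- The three possible contents of a position. -/
inductive Site where
  | particle
  | antiparticle
  | empty

section Collapse

variable {V : Type*} [AddGroupWithOne V]

open Classical in
/-- The positions are the elements of `V`, which is `ℤ` or `ZMod N`; the position `k` steps to the
left of `v` is `v - k`. The first position, among `v, v - 1, v - 2, …`, that is not in `B` (the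
occupied positions), or `none` if there is no such position. -/
noncomputable def firstFree (B : Set V) (v : V) : Option V :=
  if h : ∃ k : ℕ, v - (k : V) ∉ B then some (v - (Nat.find h : V)) else none

/-- The position that receives a particle when the location `s` is checked, in the procedure where
antiparticles are first placed on `T` and the locations in `S` are then checked in the order given
by the well-order `r`. The positions occupied at that moment are those in `T` and those which
received a particle at an earlier location `s'` of `S`. The value is `none` if there is no
empty position at `s` or to the left of it. -/
noncomputable def landing (r : V → V → Prop) [IsWellOrder V r] (S T : Set V) : V → Option V :=
  IsWellFounded.fix r fun s earlier =>
    firstFree (T ∪ {v | ∃ (s' : V) (h : r s' s), s' ∈ S ∧ earlier s' h = some v}) s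

open Classical in
/-- The state that results from the collapsing procedure with the order `r`. -/
noncomputable def collapseWithOrder (r : V → V → Prop) [IsWellOrder V r] (S T : Set V) :
    V → Site := fun v =>
  if v ∈ T then .antiparticle
  else if ∃ s ∈ S, landing r S T s = some v then .particle
  else .empty

/-- `S` and `T` collapse to the state `x`: it is the result of the collapsing procedure for
some order in which the locations of `S` are checked. -/
def CollapsesTo (S T : Set V) (x : V → Site) : Prop :=
  ∃ (r : V → V → Prop) (_ : IsWellOrder V r), x = collapseWithOrder r S T

end Collapse

/-- The set of positions of the particles of a state. -/
def particlePositions {V : Type*} (x : V → Site) : Set V := {v | x v = .particle}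

/-! The collapse is a discrete-time queue read from right to left: elements of `S` are arrivals,
elements of `Tᶜ` are offered services, and particles sit where a service is used. The checking order
only affects which arrival is served where, so `S'` is a function of `S` and `T` alone.

On the cycle, `a + b ≤ N` guarantees that every arrival lands, and counting the particles that pass
each position gives a stationary queue. Two queues with the same input have the same departures
(`IsQueue.unique`), since their distance cannot decrease all the way around. Reversing direction
(`IsQueue.neg`) exchanges arrivals and departures, with `dualServices` in the role of `T`. Hence
`(S, T) ↦ (departures, dualServices)` is injective and preserves both cardinalities, so it permutes
the finite set of admissible pairs and preserves the uniform law. This is a finite form of Burke's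
theorem.

On the line, `v` receives a particle iff it is not in `T` and some window starting at `v` has
nonnegative excess, that is, iff `v` uses its service in a queue started empty far enough to the
right (`particlePositions_eq_of_collapsesTo`). Under Bernoulli input the queue length is a
birth-death chain, and the probability of departures on a finite set is a product of operators
applied to the constant 1 (`integral_departsWithin`). If `p + q < 1`, the geometric law of ratio `q
* p / ((1 - q) * (1 - p))` is stationary and each required departure contributes a factor `p`
(`HasSum.servedOp`). If `p + q ≥ 1`, the limiting probability of an empty queue is zero whenever `(1
- q) * (1 - p) > 0`; in all cases almost every service is used and `S' = Tᶜ` almost surely. -/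

/-! ### Where particles land for a fixed checking order. -/

section Landing

variable {V : Type*} [AddGroupWithOne V]

/-- The positions that are occupied when the location `s` is checked. -/
def occupiedBefore (r : V → V → Prop) [IsWellOrder V r] (S T : Set V) (s : V) : Set V :=
  T ∪ {v | ∃ s', r s' s ∧ s' ∈ S ∧ landing r S T s' = some v}

theorem landing_eq_firstFree (r : V → V → Prop) [IsWellOrder V r] (S T : Set V) (s : V) :
    landing r S T s = firstFree (occupiedBefore r S T s) s := by
  rw [landing, IsWellFounded.fix_eq]
  simp only [occupiedBefore, exists_prop]
  rfl

theorem firstFree_eq_some {B : Set V} {s v : V} (h : firstFree B s = some v) :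
    ∃ k : ℕ, s - k = v ∧ v ∉ B ∧ ∀ i < k, s - (i : V) ∈ B := by
  classical
  unfold firstFree at h
  split_ifs at h with hk
  simp only [Option.some.injEq] at h
  refine ⟨_, h, h ▸ Nat.find_spec hk, fun i hi => ?_⟩
  simpa using Nat.find_min hk hi

theorem firstFree_eq_none {B : Set V} {s : V} (h : firstFree B s = none) (k : ℕ) :
    s - (k : V) ∈ B := by
  unfold firstFree at h
  split_ifs at h with hk
  simpa using not_exists.1 hk k

theorem firstFree_of_notMem {B : Set V} {s : V} {k : ℕ} (h : s - (k : V) ∉ B) :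
    ∃ i ≤ k, firstFree B s = some (s - (i : V)) := by
  classical
  have hk : ∃ k : ℕ, s - (k : V) ∉ B := ⟨k, h⟩
  exact ⟨Nat.find hk, Nat.find_min' hk h, by simp only [firstFree, dif_pos hk]⟩

variable {r : V → V → Prop} [IsWellOrder V r] {S T : Set V}

theorem landing_notMem {s v : V} (h : landing r S T s = some v) : v ∉ T := by
  rw [landing_eq_firstFree] at h
  obtain ⟨k, -, hv, -⟩ := firstFree_eq_some h
  exact fun hT => hv (Or.inl hT)

theorem landing_ne_of_rel {s s' v : V} (hs' : s' ∈ S) (hr : r s' s)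
    (h' : landing r S T s' = some v) : landing r S T s ≠ some v := by
  intro h
  rw [landing_eq_firstFree] at h
  obtain ⟨k, -, hv, -⟩ := firstFree_eq_some h
  exact hv (Or.inr ⟨s', hr, hs', h'⟩)

theorem landing_injOn {s s' v : V} (hs : s ∈ S) (hs' : s' ∈ S) (h : landing r S T s = some v)
    (h' : landing r S T s' = some v) : s = s' := by
  rcases trichotomous_of r s s' with hr | hr | hr
  · exact absurd h' (landing_ne_of_rel hs hr h)
  · exact hr
  · exact absurd h (landing_ne_of_rel hs' hr h')

theorem mem_particlePositions_collapseWithOrder {v : V} :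
    v ∈ particlePositions (collapseWithOrder r S T) ↔ ∃ s ∈ S, landing r S T s = some v := by
  simp only [particlePositions, collapseWithOrder, Set.mem_ofPred_eq]
  constructor
  · intro h
    split_ifs at h with h1 h2
    exact h2
  · intro h
    obtain ⟨s, hs, hv⟩ := h
    rw [if_neg (landing_notMem hv), if_pos ⟨s, hs, hv⟩]

end Landing

/-! ### Landing forces a window of nonnegative excess. -/

section Excess

variable {V : Type*} [AddGroupWithOne V]

open Classical in
/-- The number of elements of `S` plus the number of elements of `T` minus the number of positions,
among the `n` positions `v, v + 1, …`, counted with multiplicity. -/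
noncomputable def excess (S T : Set V) (v : V) (n : ℕ) : ℤ :=
  ∑ i ∈ Finset.range n,
    ((if v + (i : V) ∈ S then 1 else 0) + (if v + (i : V) ∈ T then 1 else 0) - 1)

theorem excess_add (S T : Set V) (v : V) (m n : ℕ) :
    excess S T v (m + n) = excess S T v m + excess S T (v + m) n := by
  rw [excess, Finset.sum_range_add]
  refine congrArg _ (Finset.sum_congr rfl fun i _ => ?_)
  rw [Nat.cast_add, add_assoc]

open Classical in
theorem excess_one (S T : Set V) (v : V) :
    excess S T v 1 = (if v ∈ S then 1 else 0) + (if v ∈ T then 1 else 0) - 1 := by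
  simp [excess]

theorem excess_mono {S S' : Set V} (h : S ⊆ S') (T : Set V) (v : V) (n : ℕ) :
    excess S T v n ≤ excess S' T v n := by
  refine Finset.sum_le_sum fun i _ => ?_
  have := @h (v + i)
  split_ifs <;> simp_all

theorem excess_add_one_le {S S' : Set V} (h : S ⊆ S') (T : Set V) {v : V} {n k : ℕ} (hk : k < n)
    (h1 : v + (k : V) ∉ S) (h2 : v + (k : V) ∈ S') : excess S T v n + 1 ≤ excess S' T v n := by
  refine Int.add_one_le_iff.2 (Finset.sum_lt_sum (fun i _ => ?_) ⟨k, Finset.mem_range.2 hk, ?_⟩)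
  · have := @h (v + i)
    split_ifs <;> simp_all
  · simp [h1, h2]

/-- Induction along `r`, keeping only the locations checked no later than `s`. When `s` is checked,
the positions from just right of `p` up to `s` are all occupied; windows supplied by the elements of
`T` and by earlier landings are concatenated to cover them. -/
theorem exists_excess_nonneg_of_landing_aux {r : V → V → Prop} [IsWellOrder V r] {S T : Set V}
    (s : V) : ∀ p, s ∈ S → landing r S T s = some p →
      ∃ n, 1 ≤ n ∧ 0 ≤ excess {x ∈ S | ¬ r s x} T p n := by
  induction s using IsWellFounded.induction r with
  | _ s ih =>
  intro p hs hp
  rw [landing_eq_firstFree] at hp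
  obtain ⟨k, rfl, -, hk⟩ := firstFree_eq_some hp
  -- The window may overshoot `j`. Only when it ends exactly there must it be extended, through the
  -- occupied position that follows it.
  have key : ∀ j ≤ k, ∃ n, j ≤ n ∧ 0 ≤ excess {x ∈ S | r x s} T (s - (k : V) + 1) n := by
    intro j
    induction j with
    | zero => exact fun _ => ⟨0, le_rfl, by simp [excess]⟩
    | succ j ihj =>
      intro hj
      obtain ⟨n, hn, hex⟩ := ihj (by omega)
      rcases hn.lt_or_eq with hlt | rfl
      · exact ⟨n, hlt, hex⟩
      have hmem : s - (k : V) + 1 + (j : V) ∈ occupiedBefore r S T s := by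
        convert hk (k - 1 - j) (by omega) using 1
        have : (k : V) = ((1 + j : ℕ) : V) + ((k - 1 - j : ℕ) : V) := by
          rw [← Nat.cast_add]; congr 1; omega
        rw [this, sub_add_eq_sub_sub_swap, add_assoc _ (1 : V), ← Nat.cast_one (R := V),
          ← Nat.cast_add (R := V), sub_add_cancel]
      rcases hmem with hT | ⟨s', hr, hs', hl⟩
      · refine ⟨j + 1, le_rfl, ?_⟩
        rw [excess_add, excess_one, if_pos hT]
        split_ifs <;> linarith
      · obtain ⟨n', hn', hex'⟩ := ih s' hr _ hs' hl
        refine ⟨j + n', by omega, ?_⟩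
        rw [excess_add]
        have : excess {x ∈ S | ¬ r s' x} T (s - (k : V) + 1 + (j : V)) n' ≤
            excess {x ∈ S | r x s} T (s - (k : V) + 1 + (j : V)) n' := by
          refine excess_mono ?_ _ _ _
          rintro x ⟨hx, hrx⟩
          refine ⟨hx, ?_⟩
          rcases trichotomous_of r x s' with h | h | h
          · exact trans_of r h hr
          · exact h ▸ hr
          · exact absurd h hrx
        linarith
  obtain ⟨n, hn, hex⟩ := key k le_rfl
  refine ⟨1 + n, by omega, ?_⟩
  -- Adding `p` to the window costs at most one; allowing `s` itself, at offset `k`, gains that one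
  -- back.
  have h1 := excess_add_one_le (S := {x ∈ S | r x s}) (S' := {x ∈ S | ¬ r s x}) (T := T)
    (v := s - (k : V)) (n := 1 + n) (k := k) (fun x hx => ⟨hx.1, asymm_of r hx.2⟩) (by omega)
    (by simpa using fun _ => irrefl_of r s) (by simpa using ⟨hs, irrefl_of r s⟩)
  rw [excess_add, Nat.cast_one] at h1
  have h2 : -1 ≤ excess {x ∈ S | r x s} T (s - (k : V)) 1 := by
    rw [excess_one]
    split_ifs <;> norm_num
  linarith

theorem exists_excess_nonneg_of_landing {r : V → V → Prop} [IsWellOrder V r] {S T : Set V}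
    {s p : V} (hs : s ∈ S) (hp : landing r S T s = some p) :
    ∃ n, 1 ≤ n ∧ 0 ≤ excess S T p n := by
  obtain ⟨n, hn, h⟩ := exists_excess_nonneg_of_landing_aux s p hs hp
  exact ⟨n, hn, h.trans (excess_mono (fun x hx => hx.1) _ _ _)⟩

end Excess

/-! ### On the line: particle positions as used services of a queue. -/

section Line

/-- A search never passes a position that stays empty. So the elements of `S` in the window land
injectively on its positions outside `T`, with `v` itself left over. -/
theorem excess_neg_of_forall_landing_ne {r : ℤ → ℤ → Prop} [IsWellOrder ℤ r] {S T : Set ℤ} {v : ℤ}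
    (hT : v ∉ T) (hv : ∀ s ∈ S, landing r S T s ≠ some v) {n : ℕ} (hn : 1 ≤ n) :
    excess S T v n < 0 := by
  classical
  have hocc : ∀ s, v ∉ occupiedBefore r S T s := by
    rintro s (h | ⟨s', -, hs', h⟩)
    · exact hT h
    · exact hv s' hs' h
  have hland : ∀ i : ℕ, v + i ∈ S → ∃ j ≤ i, j ≠ 0 ∧ landing r S T (v + i) = some (v + j) := by
    intro i hi
    obtain ⟨k, hk, h⟩ := firstFree_of_notMem (B := occupiedBefore r S T (v + i)) (s := v + i)
      (k := i) (by simpa using hocc _)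
    rw [← landing_eq_firstFree] at h
    have h' : v + (i : ℤ) - ((k : ℕ) : ℤ) = v + ((i - k : ℕ) : ℤ) := by omega
    replace h := h.trans (congrArg some h')
    refine ⟨i - k, by omega, fun h0 => hv _ hi ?_, h⟩
    rw [h, h0]; simp
  choose! f hf hf0 hfl using hland
  have hcard : ((Finset.range n).filter fun i : ℕ => v + i ∈ S).card ≤
      (((Finset.range n).filter fun i : ℕ => v + i ∉ T).erase 0).card := by
    refine Finset.card_le_card_of_injOn f (fun i hi => ?_) (fun i hi j hj hij => ?_)
    · simp only [Finset.coe_filter, Finset.mem_range, Set.mem_ofPred_eq] at hi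
      simp only [Finset.coe_erase, Finset.coe_filter, Finset.mem_range, Set.mem_sdiff,
        Set.mem_ofPred_eq, Set.mem_singleton_iff]
      exact ⟨⟨(hf i hi.2).trans_lt hi.1, landing_notMem (hfl i hi.2)⟩, hf0 i hi.2⟩
    · simp only [Finset.coe_filter, Finset.mem_range, Set.mem_ofPred_eq] at hi hj
      have := landing_injOn hi.2 hj.2 (hfl i hi.2) (hij ▸ hfl j hj.2)
      omega
  rw [Finset.card_erase_of_mem (by simp [hT]; omega)] at hcard
  have hpos : 0 < ((Finset.range n).filter fun i : ℕ => v + i ∉ T).card :=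
    Finset.card_pos.2 ⟨0, by simp [hT]; omega⟩
  have hsum := Finset.card_filter_add_card_filter_not (s := Finset.range n)
    (fun i : ℕ => v + (i : ℤ) ∈ T)
  have : excess S T v n = (((Finset.range n).filter fun i : ℕ => v + i ∈ S).card : ℤ)
      + ((Finset.range n).filter fun i : ℕ => v + i ∈ T).card - n := by
    simp only [excess, Finset.sum_sub_distrib, Finset.sum_add_distrib, Finset.card_filter]
    push_cast
    simp
  rw [Finset.card_range] at hsum
  omega

open Classical in
/-- The number of unserved customers after position `v` in a queue which starts empty, and in which
the positions `v + n - 1, …, v + 1, v` are visited in this order: there is an arrival at the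
elements of `S`, and a service at the elements of `Tᶜ`. -/
noncomputable def queueLength (S T : Set ℤ) : ℕ → ℤ → ℕ
  | 0, _ => 0
  | n + 1, v => queueLength S T n (v + 1) + (if v ∈ S then 1 else 0) - (if v ∈ T then 0 else 1)

open Classical in
/-- The position `v` serves a customer in the queue that starts at position `v + n`. -/
def ServedWithin (S T : Set ℤ) (n : ℕ) (v : ℤ) : Prop :=
  v ∉ T ∧ 1 ≤ queueLength S T n (v + 1) + (if v ∈ S then 1 else 0)

theorem excess_succ (S T : Set ℤ) (v : ℤ) (n : ℕ) :
    excess S T v (n + 1) = excess S T v 1 + excess S T (v + 1) n := by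
  rw [add_comm, excess_add, Nat.cast_one]

/-- Half of Lindley's formula: the queue length is the maximal excess over windows of length at most
`n` starting at `v`. The next lemma shows that the maximum is attained. -/
theorem excess_le_queueLength (S T : Set ℤ) {m n : ℕ} (hmn : m ≤ n) (v : ℤ) :
    excess S T v m ≤ queueLength S T n v := by
  induction n generalizing m v with
  | zero =>
    obtain rfl : m = 0 := by omega
    simp [excess]
  | succ n ih =>
    rcases m with _ | m
    · simp [excess]
    · have := ih (m := m) (by omega) (v + 1)
      rw [excess_succ, excess_one, queueLength]
      split_ifs <;> omega

theorem exists_queueLength_eq_excess (S T : Set ℤ) (n : ℕ) (v : ℤ) :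
    ∃ m ≤ n, (queueLength S T n v : ℤ) = excess S T v m := by
  induction n generalizing v with
  | zero => exact ⟨0, le_rfl, by simp [excess, queueLength]⟩
  | succ n ih =>
    by_cases h : queueLength S T (n + 1) v = 0
    · exact ⟨0, by omega, by simp [excess, h]⟩
    · obtain ⟨m, hm, hq⟩ := ih (v + 1)
      refine ⟨m + 1, by omega, ?_⟩
      rw [excess_succ, excess_one, ← hq]
      rw [queueLength] at h ⊢
      split_ifs at h ⊢ <;> omega

theorem exists_servedWithin_iff {S T : Set ℤ} {v : ℤ} :
    (∃ n, ServedWithin S T n v) ↔ v ∉ T ∧ ∃ n, 1 ≤ n ∧ 0 ≤ excess S T v n := by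
  constructor
  · rintro ⟨n, hT, hn⟩
    obtain ⟨m, -, hm⟩ := exists_queueLength_eq_excess S T n (v + 1)
    refine ⟨hT, m + 1, by omega, ?_⟩
    rw [excess_succ, excess_one, ← hm, if_neg hT]
    split_ifs at hn ⊢ <;> omega
  · rintro ⟨hT, n, hn, hex⟩
    obtain ⟨n, rfl⟩ := Nat.exists_eq_add_of_le' hn
    refine ⟨n, hT, ?_⟩
    have := excess_le_queueLength S T (le_refl n) (v + 1)
    rw [excess_succ, excess_one, if_neg hT] at hex
    split_ifs at hex ⊢ <;> omega

theorem particlePositions_eq_of_collapsesTo {S T : Set ℤ} {x : ℤ → Site} (h : CollapsesTo S T x) :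
    particlePositions x = {v | ∃ n, ServedWithin S T n v} := by
  obtain ⟨r, hr, rfl⟩ := h
  ext v
  rw [mem_particlePositions_collapseWithOrder, Set.mem_ofPred_eq, exists_servedWithin_iff]
  constructor
  · rintro ⟨s, hs, hl⟩
    exact ⟨landing_notMem hl, exists_excess_nonneg_of_landing hs hl⟩
  · rintro ⟨hT, n, hn, hex⟩
    by_contra! hv
    exact absurd (excess_neg_of_forall_landing_ne hT hv hn) (by omega)

end Line

/-! ### On the cycle: uniqueness and reversal of the queue. -/

section Cycle

open Classical in
/-- `Q` describes the lengths of a queue that visits the positions from right to left, with arrivals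
at `S`, services at `Tᶜ` and departures at `A`; the length after the visit of `v` is `Q v`. -/
structure IsQueue {V : Type*} [AddCommGroupWithOne V] (S T A : Set V) (Q : V → ℕ) : Prop where
  notMem : ∀ v ∈ A, v ∉ T
  balance : ∀ v, Q v + (if v ∈ A then 1 else 0) = Q (v + 1) + (if v ∈ S then 1 else 0)
  idle : ∀ v, v ∉ T → v ∉ A → Q (v + 1) = 0 ∧ v ∉ S

variable {V : Type*} [AddCommGroupWithOne V]

/-- A particle skips only occupied positions, so a position that ends up empty is never visited by
any search, which is the idling rule. -/
theorem isQueue_of_landing [Fintype V] {r : V → V → Prop} [IsWellOrder V r]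
    {S T : Set V} (h : ∀ s ∈ S, landing r S T s ≠ none) :
    ∃ Q, IsQueue S T (particlePositions (collapseWithOrder r S T)) Q := by
  classical
  have hk : ∀ s ∈ S, ∃ k : ℕ, landing r S T s = some (s - (k : V)) ∧
      ∀ i < k, s - (i : V) ∈ occupiedBefore r S T s := by
    intro s hs
    obtain ⟨p, hp⟩ := Option.ne_none_iff_exists'.1 (h s hs)
    have hp' := hp
    rw [landing_eq_firstFree] at hp'
    obtain ⟨k, rfl, -, hk⟩ := firstFree_eq_some hp'
    exact ⟨k, hp, hk⟩
  choose! k hland hocc using hk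
  have hmem : ∀ v, v ∈ particlePositions (collapseWithOrder r S T) ↔
      ∃ s ∈ S, s - (k s : V) = v := by
    intro v
    rw [mem_particlePositions_collapseWithOrder]
    refine exists_congr fun s => and_congr_right fun hs => ?_
    rw [hland s hs, Option.some.injEq]
  have hfree : ∀ v, v ∉ T → v ∉ particlePositions (collapseWithOrder r S T) → ∀ s ∈ S,
      ∀ i ≤ k s, s - (i : V) ≠ v := by
    rintro v hT hA s hs i hi rfl
    rcases hi.lt_or_eq with hi | rfl
    · rcases hocc s hs i hi with h | ⟨s', -, hs', h⟩
      · exact hT h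
      · exact hA (mem_particlePositions_collapseWithOrder.2 ⟨s', hs', h⟩)
    · exact hA ((hmem _).2 ⟨s, hs, rfl⟩)
  -- The queue length at `v` counts the searches that continue from `v` to `v - 1`.
  refine ⟨fun v => ∑ s ∈ S.toFinset, ∑ i ∈ Finset.range (k s),
    if s - (i : V) = v then 1 else 0, ?_, ?_, ?_⟩
  · intro v hv
    obtain ⟨s, hs, hl⟩ := mem_particlePositions_collapseWithOrder.1 hv
    exact landing_notMem hl
  · intro v
    have h1 : (if v ∈ S then 1 else 0) = ∑ s ∈ S.toFinset, if s = v then 1 else 0 := by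
      simp
    have h2 : (if v ∈ particlePositions (collapseWithOrder r S T) then 1 else 0) =
        ∑ s ∈ S.toFinset, if s - (k s : V) = v then 1 else 0 := by
      split_ifs with hv
      · obtain ⟨s, hs, rfl⟩ := (hmem v).1 hv
        rw [Finset.sum_eq_single s]
        · simp
        · intro s' hs' hne
          rw [Set.mem_toFinset] at hs'
          refine if_neg fun he => hne ?_
          exact landing_injOn (r := r) hs' hs (hland s' hs') (he ▸ hland s hs)
        · simp [hs]
      · refine (Finset.sum_eq_zero fun s hs => if_neg fun he => hv ?_).symm
        exact (hmem v).2 ⟨s, Set.mem_toFinset.1 hs, he⟩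
    rw [h1, h2, ← Finset.sum_add_distrib, ← Finset.sum_add_distrib]
    refine Finset.sum_congr rfl fun s _ => ?_
    rw [← Finset.sum_range_succ fun i : ℕ => if s - (i : V) = v then 1 else 0,
      Finset.sum_range_succ']
    congr 1
    · refine Finset.sum_congr rfl fun i _ => if_congr ?_ rfl rfl
      rw [Nat.cast_succ, ← sub_sub, sub_eq_iff_eq_add (b := (1 : V))]
    · simp
  · intro v hT hA
    refine ⟨Finset.sum_eq_zero fun s hs => Finset.sum_eq_zero fun i hi => if_neg fun he => ?_,
      fun hs => hfree v hT hA v hs 0 (Nat.zero_le _) (by simp)⟩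
    refine hfree v hT hA s (Set.mem_toFinset.1 hs) (i + 1) (Finset.mem_range.1 hi) ?_
    rw [Nat.cast_succ, ← sub_sub, he, add_sub_cancel_right]

theorem IsQueue.ncard_eq [Fintype V] {S T A : Set V} {Q : V → ℕ} (h : IsQueue S T A Q) :
    A.ncard = S.ncard := by
  classical
  have key : ∑ v, (Q v + (if v ∈ A then 1 else 0)) = ∑ v, (Q (v + 1) + (if v ∈ S then 1 else 0)) :=
    Finset.sum_congr rfl fun v _ => by convert h.balance v
  have hQ : ∑ v, Q (v + 1) = ∑ v, Q v := Equiv.sum_comp (Equiv.addRight (1 : V)) Q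
  rw [Finset.sum_add_distrib, Finset.sum_add_distrib, hQ, Nat.add_left_cancel_iff] at key
  rw [Set.ncard_eq_toFinset_card', Set.ncard_eq_toFinset_card']
  simpa using key

/-- Common arrivals and services cannot push two queues apart. If only one of them uses the service
at `v`, the other is empty, and the distance drops by exactly one. -/
theorem IsQueue.natAbs_sub_le {S T A A' : Set V} {Q Q' : V → ℕ} (h : IsQueue S T A Q)
    (h' : IsQueue S T A' Q') (v : V) :
    ((Q v : ℤ) - Q' v).natAbs ≤ ((Q (v + 1) : ℤ) - Q' (v + 1)).natAbs ∧
      (((Q v : ℤ) - Q' v).natAbs = ((Q (v + 1) : ℤ) - Q' (v + 1)).natAbs → (v ∈ A ↔ v ∈ A')) := by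
  have hb := h.balance v
  have hb' := h'.balance v
  by_cases hA : v ∈ A <;> by_cases hA' : v ∈ A'
  · rw [if_pos hA] at hb
    rw [if_pos hA'] at hb'
    simp only [hA, hA', implies_true, and_true]
    omega
  · obtain ⟨h1, h2⟩ := h'.idle v (h.notMem v hA) hA'
    rw [if_pos hA, if_neg h2] at hb
    rw [if_neg hA', if_neg h2] at hb'
    simp only [hA, hA']
    omega
  · obtain ⟨h1, h2⟩ := h.idle v (h'.notMem v hA') hA
    rw [if_neg hA, if_neg h2] at hb
    rw [if_pos hA', if_neg h2] at hb'
    simp only [hA, hA']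
    omega
  · rw [if_neg hA] at hb
    rw [if_neg hA'] at hb'
    simp only [hA, hA', implies_true, and_true]
    omega

/-- Both sides of the pointwise inequality have the same sum around the cycle, so equality holds
everywhere and the departures agree. -/
theorem IsQueue.unique [Fintype V] {S T A A' : Set V} {Q Q' : V → ℕ} (h : IsQueue S T A Q)
    (h' : IsQueue S T A' Q') : A = A' := by
  have heq := (Finset.sum_eq_sum_iff_of_le (s := Finset.univ)
    fun v _ => (h.natAbs_sub_le h' v).1).1
    (Equiv.sum_comp (Equiv.addRight (1 : V)) fun v => ((Q v : ℤ) - Q' v).natAbs).symm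
  ext v
  exact (h.natAbs_sub_le h' v).2 (heq v (Finset.mem_univ v))

theorem IsQueue.subset {S T A : Set V} {Q : V → ℕ} (h : IsQueue S T A Q) : S ⊆ T ∪ A := by
  intro v hv
  by_contra hn
  rw [Set.mem_union, not_or] at hn
  exact (h.idle v hn.1 hn.2).2 hv

/-- Run backwards, customers enter at the old departures and leave at the old arrivals. The reversed
services are the old arrivals together with the old unused services, whose complement is `(T ∪ A) \
S`. -/
theorem IsQueue.neg {S T A : Set V} {Q : V → ℕ} (h : IsQueue S T A Q) :
    IsQueue (Neg.neg ⁻¹' A) (Neg.neg ⁻¹' ((T ∪ A) \ S)) (Neg.neg ⁻¹' S) fun v => Q (-v + 1) := by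
  refine ⟨fun v hv hv' => hv'.2 hv, fun v => ?_, fun v hT hS => ?_⟩
  · have := h.balance (-v)
    rw [show -(v + 1) + 1 = -v by abel]
    exact this.symm
  · have hS' : -v ∉ S := hS
    have hT' : -v ∉ T ∪ A := fun hn => hT ⟨hn, hS'⟩
    rw [Set.mem_union, not_or] at hT'
    have h0 := h.balance (-v)
    rw [(h.idle _ hT'.1 hT'.2).1, if_neg hT'.2, if_neg hS'] at h0
    rw [show -(v + 1) + 1 = -v by abel]
    exact ⟨h0, hT'.2⟩

/-- The positions of the particles after the collapsing procedure, for an arbitrary choice of the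
order. -/
noncomputable def departures (S T : Set V) : Set V :=
  particlePositions (collapseWithOrder WellOrderingRel S T)

/-- The complement of the services of the time-reversed queue. -/
noncomputable def dualServices (S T : Set V) : Set V := (T ∪ departures S T) \ S

variable {N : ℕ} [NeZero N] {S T : Set (ZMod N)}

theorem landing_ne_none (r : ZMod N → ZMod N → Prop) [IsWellOrder (ZMod N) r]
    (h : S.ncard + T.ncard ≤ N) {s : ZMod N} (hs : s ∈ S) : landing r S T s ≠ none := by
  intro hn
  rw [landing_eq_firstFree] at hn
  -- A failed search means that all `N` positions are taken by `T` and by particles from `S \ {s}`,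
  -- which are too few. The default `0` can only enlarge the image by a point and not its
  -- cardinality bound.
  have huniv : Set.univ ⊆ T ∪ (fun s => (landing r S T s).getD 0) '' (S \ {s}) := by
    intro v _
    have hv := firstFree_eq_none hn (s - v).val
    rw [ZMod.natCast_zmod_val, sub_sub_cancel] at hv
    rcases hv with hT | ⟨s', hr, hs', hl⟩
    · exact Or.inl hT
    · refine Or.inr ⟨s', ⟨hs', ?_⟩, by simp [hl]⟩
      rintro rfl
      exact irrefl_of r _ hr
  have h1 := Set.ncard_le_ncard huniv (Set.toFinite _)
  have h2 := Set.ncard_union_le T ((fun s => (landing r S T s).getD 0) '' (S \ {s}))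
  have h3 := Set.ncard_image_le (f := fun s => (landing r S T s).getD 0) (Set.toFinite (S \ {s}))
  have h4 := Set.ncard_sdiff_singleton_lt_of_mem hs (Set.toFinite _)
  rw [Set.ncard_univ, Nat.card_zmod] at h1
  omega

theorem exists_isQueue_departures (h : S.ncard + T.ncard ≤ N) :
    ∃ Q, IsQueue S T (departures S T) Q :=
  isQueue_of_landing fun _ hs => landing_ne_none _ h hs

theorem particlePositions_eq_departures (h : S.ncard + T.ncard ≤ N) {x : ZMod N → Site}
    (hx : CollapsesTo S T x) : particlePositions x = departures S T := by
  obtain ⟨r, hr, rfl⟩ := hx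
  obtain ⟨Q, hQ⟩ := exists_isQueue_departures h
  obtain ⟨Q', hQ'⟩ := isQueue_of_landing (r := r) fun _ hs => landing_ne_none r h hs
  exact hQ'.unique hQ

theorem ncard_departures (h : S.ncard + T.ncard ≤ N) : (departures S T).ncard = S.ncard :=
  (exists_isQueue_departures h).choose_spec.ncard_eq

theorem ncard_dualServices (h : S.ncard + T.ncard ≤ N) : (dualServices S T).ncard = T.ncard := by
  obtain ⟨Q, hQ⟩ := exists_isQueue_departures h
  rw [dualServices, Set.ncard_sdiff hQ.subset (Set.toFinite _),
    Set.ncard_union_eq (Set.disjoint_right.2 hQ.notMem) (Set.toFinite _) (Set.toFinite _),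
    hQ.ncard_eq, Nat.add_sub_cancel]

/-- Uniqueness for the reversed queue recovers `S` from the output pair; then `T` is what remains of
`dualServices S T ∪ S` once the departures are removed. -/
theorem eq_of_departures_eq_of_dualServices_eq {S' T' : Set (ZMod N)} (h : S.ncard + T.ncard ≤ N)
    (h' : S'.ncard + T'.ncard ≤ N) (hA : departures S T = departures S' T')
    (hT : dualServices S T = dualServices S' T') : S = S' ∧ T = T' := by
  obtain ⟨Q, hQ⟩ := exists_isQueue_departures h
  obtain ⟨Q', hQ'⟩ := exists_isQueue_departures h'
  have hS : S = S' := by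
    have hneg := hQ'.neg
    change IsQueue _ (Neg.neg ⁻¹' dualServices S' T') _ _ at hneg
    rw [← hA, ← hT] at hneg
    exact Set.preimage_injective.2 neg_surjective (hQ.neg.unique hneg)
  refine ⟨hS, ?_⟩
  have key : ∀ {S T : Set (ZMod N)} {Q}, IsQueue S T (departures S T) Q →
      T = (dualServices S T ∪ S) \ departures S T := by
    intro S T Q hQ
    ext v
    have := hQ.notMem v
    have := mt (hQ.subset (a := v))
    simp only [dualServices, Set.mem_sdiff, Set.mem_union] at this ⊢
    tauto
  rw [key hQ, key hQ', hA, hT, hS]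

end Cycle

/-! ### On the cycle: invariance of the uniform law. -/

section CycleLaw

theorem uniformOn_prod {α β : Type*} [Finite α] [Finite β] [MeasurableSpace α] [MeasurableSpace β]
    [MeasurableSingletonClass α] [MeasurableSingletonClass β] (s : Set α) (t : Set β) :
    (uniformOn s).prod (uniformOn t) = uniformOn (s ×ˢ t) := by
  classical
  refine Measure.prod_eq fun A B _ _ => ?_
  lift s to Finset α using Set.toFinite _
  lift t to Finset β using Set.toFinite _
  lift A to Finset α using Set.toFinite _
  lift B to Finset β using Set.toFinite _
  rw [← Finset.coe_product, ← Finset.coe_product, uniformOn_apply_finset, uniformOn_apply_finset,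
    uniformOn_apply_finset, Finset.product_inter_product, Finset.card_product, Finset.card_product,
    Nat.cast_mul, Nat.cast_mul, ENNReal.mul_div_mul_comm (by simp) (by simp)]

theorem uniformOn_preimage_of_mapsTo {α : Type*} [Finite α] [MeasurableSpace α]
    [MeasurableSingletonClass α] {s : Set α} {f : α → α} (hf : Set.MapsTo f s s)
    (hinj : Set.InjOn f s) (E : Set α) : uniformOn s (f ⁻¹' E) = uniformOn s E := by
  classical
  have hsurj : Set.SurjOn f s s := by
    exact (Set.eq_of_subset_of_ncard_le hf.image_subset hinj.ncard_image.ge (Set.toFinite _)).ge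
  have hcard : (s ∩ f ⁻¹' E).ncard = (s ∩ E).ncard := by
    rw [← (hinj.mono Set.inter_subset_left).ncard_image]
    congr 1
    ext y
    constructor
    · rintro ⟨x, ⟨hx, hE⟩, rfl⟩
      exact ⟨hf hx, hE⟩
    · rintro ⟨hy, hE⟩
      obtain ⟨x, hx, rfl⟩ := hsurj hy
      exact ⟨x, ⟨hx, hE⟩, rfl⟩
  generalize f ⁻¹' E = F at hcard ⊢
  lift s to Finset α using Set.toFinite _
  lift E to Finset α using Set.toFinite _
  lift F to Finset α using Set.toFinite _
  rw [← Finset.coe_inter, ← Finset.coe_inter, Set.ncard_coe_finset, Set.ncard_coe_finset] at hcard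
  rw [uniformOn_apply_finset, uniformOn_apply_finset, hcard]

theorem hasLaw_prodMk {Ω α β : Type*} [MeasurableSpace Ω] [MeasurableSpace α] [MeasurableSpace β]
    {P : Measure Ω} [IsProbabilityMeasure P] {X : Ω → α} {Y : Ω → β} {μ : Measure α}
    {ν : Measure β} (hX : HasLaw X μ P) (hY : HasLaw Y ν P) (h : IndepFun X Y P) :
    HasLaw (fun ω => (X ω, Y ω)) (μ.prod ν) P where
  aemeasurable := hX.aemeasurable.prodMk hY.aemeasurable
  map_eq := by
    rw [(indepFun_iff_map_prod_eq_prod_map_map hX.aemeasurable hY.aemeasurable).1 h, hX.map_eq,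
      hY.map_eq]

theorem hasLaw_particlePositions_cycle {Ω : Type*} [MeasurableSpace Ω] (P : Measure Ω)
    [IsProbabilityMeasure P] (N : ℕ) [NeZero N] (a b : ℕ) (hab : a + b ≤ N)
    (S T : Ω → Set (ZMod N)) (x : Ω → ZMod N → Site)
    (hS : HasLaw S (uniformOn {A : Set (ZMod N) | A.ncard = a}) P)
    (hT : HasLaw T (uniformOn {B : Set (ZMod N) | B.ncard = b}) P)
    (hST : IndepFun S T P) (hx : ∀ᵐ ω ∂P, CollapsesTo (S ω) (T ω) (x ω)) :
    HasLaw (fun ω => particlePositions (x ω))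
      (uniformOn {A : Set (ZMod N) | A.ncard = a}) P := by
  have hprob := hS.isProbabilityMeasure_iff.1 ‹_›
  have hprob' := hT.isProbabilityMeasure_iff.1 ‹_›
  have hpair := hasLaw_prodMk hS hT hST
  set Xa := {A : Set (ZMod N) | A.ncard = a}
  set Xb := {B : Set (ZMod N) | B.ncard = b}
  have hmem : ∀ {c : ℕ} {R : Ω → Set (ZMod N)},
      HasLaw R (uniformOn {A : Set (ZMod N) | A.ncard = c}) P → ∀ᵐ ω ∂P, (R ω).ncard = c := by
    intro c R hR
    rw [hR.ae_iff (p := fun A => A.ncard = c) (by fun_prop)]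
    exact ae_cond_mem (.of_discrete)
  have hdep : HasLaw (fun z : Set (ZMod N) × Set (ZMod N) => departures z.1 z.2) (uniformOn Xa)
      ((uniformOn Xa).prod (uniformOn Xb)) := by
    refine ⟨(measurable_of_countable _).aemeasurable, ?_⟩
    ext E hE
    rw [Measure.map_apply (measurable_of_countable _) hE]
    have hle : ∀ z ∈ Xa ×ˢ Xb, z.1.ncard + z.2.ncard ≤ N := by
      rintro ⟨A, B⟩ ⟨hA, hB⟩
      change A.ncard = a at hA
      change B.ncard = b at hB
      simpa [hA, hB] using hab
    -- The pair map permutes `Xa ×ˢ Xb`; the event `E ×ˢ Set.univ` extracts the marginal law of the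
    -- departures.
    have := uniformOn_preimage_of_mapsTo (s := Xa ×ˢ Xb)
      (f := fun z => (departures z.1 z.2, dualServices z.1 z.2))
      (fun z hz => ⟨(ncard_departures (hle z hz)).trans hz.1,
        (ncard_dualServices (hle z hz)).trans hz.2⟩)
      (fun z hz w hw hzw => by
        have h := Prod.ext_iff.1 hzw
        exact Prod.ext_iff.2
          (eq_of_departures_eq_of_dualServices_eq (hle z hz) (hle w hw) h.1 h.2))
      (E ×ˢ Set.univ)
    rw [← uniformOn_prod, Measure.prod_prod, measure_univ, mul_one] at this
    rw [← this]
    congr 1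
    ext z
    simp
  refine (hdep.fun_comp hpair).congr ?_
  filter_upwards [hx, hmem hS, hmem hT] with ω h1 h2 h3
  exact particlePositions_eq_departures (by omega) h1

end CycleLaw

/-! ### Transition operators of the queue and their limits. -/

section Operators

open scoped Topology
open Filter

/-- The transition operator of the queue length, when at each time there is an arrival with
probability `p`, and a service with probability `1 - q`. -/
def stepOp (p q : ℝ) (g : ℕ → ℝ) (j : ℕ) : ℝ :=
  q * (p * g (j + 1) + (1 - p) * g j) + (1 - q) * (p * g j + (1 - p) * g (j - 1))

/-- The part of the transition operator of the queue length that corresponds to a departure. -/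
def servedOp (p q : ℝ) (g : ℕ → ℝ) (j : ℕ) : ℝ :=
  (1 - q) * (p * g j + (1 - p) * if j = 0 then 0 else g (j - 1))

/-- The monotone functions on the natural numbers with values in the unit interval. -/
structure MonotoneUnit (g : ℕ → ℝ) : Prop where
  monotone : Monotone g
  nonneg : ∀ j, 0 ≤ g j
  le_one : ∀ j, g j ≤ 1

variable {p q : ℝ}

theorem stepOp_comb (a b : ℝ) (f g : ℕ → ℝ) :
    stepOp p q (fun j => a * f j + b * g j) =
      fun j => a * stepOp p q f j + b * stepOp p q g j := by
  funext j
  simp only [stepOp]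
  ring

theorem iterate_stepOp_comb (a b : ℝ) (f g : ℕ → ℝ) (n : ℕ) :
    (stepOp p q)^[n] (fun j => a * f j + b * g j) =
      fun j => a * (stepOp p q)^[n] f j + b * (stepOp p q)^[n] g j := by
  induction n with
  | zero => rfl
  | succ n ih => simp only [Function.iterate_succ_apply', ih, stepOp_comb]

theorem iterate_stepOp_one (n : ℕ) : (stepOp p q)^[n] (fun _ => 1) = fun _ => 1 := by
  refine Function.iterate_fixed ?_ n
  funext j
  simp only [stepOp]
  ring

theorem stepOp_le (hp : p ∈ Set.Icc (0 : ℝ) 1) (hq : q ∈ Set.Icc (0 : ℝ) 1) {f g : ℕ → ℝ}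
    (h : ∀ j, f j ≤ g j) (j : ℕ) : stepOp p q f j ≤ stepOp p q g j := by
  obtain ⟨hp0, hp1⟩ := hp
  obtain ⟨hq0, hq1⟩ := hq
  have := sub_nonneg.2 hp1
  have := sub_nonneg.2 hq1
  simp only [stepOp]
  gcongr <;> exact h _

theorem iterate_stepOp_le (hp : p ∈ Set.Icc (0 : ℝ) 1) (hq : q ∈ Set.Icc (0 : ℝ) 1) {f g : ℕ → ℝ}
    (h : ∀ j, f j ≤ g j) (n j : ℕ) : (stepOp p q)^[n] f j ≤ (stepOp p q)^[n] g j := by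
  induction n generalizing j with
  | zero => exact h j
  | succ n ih =>
    rw [Function.iterate_succ_apply', Function.iterate_succ_apply']
    exact stepOp_le hp hq ih j

theorem MonotoneUnit.stepOp (hp : p ∈ Set.Icc (0 : ℝ) 1) (hq : q ∈ Set.Icc (0 : ℝ) 1) {g : ℕ → ℝ}
    (h : MonotoneUnit g) : MonotoneUnit (stepOp p q g) := by
  have hle := @stepOp_le p q hp hq
  obtain ⟨hp0, hp1⟩ := hp
  obtain ⟨hq0, hq1⟩ := hq
  have := sub_nonneg.2 hp1
  have := sub_nonneg.2 hq1
  refine ⟨fun i j hij => ?_, fun j => ?_, fun j => ?_⟩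
  · simp only [_root_.stepOp]
    have h1 := h.monotone hij
    have h2 := h.monotone (Nat.add_le_add_right hij 1)
    have h3 := h.monotone (Nat.sub_le_sub_right hij 1)
    gcongr
  · exact le_of_eq_of_le (by simp [_root_.stepOp]) (hle (f := fun _ => 0) h.nonneg j)
  · exact (hle (g := fun _ => 1) h.le_one j).trans_eq (by simp only [_root_.stepOp]; ring)

theorem MonotoneUnit.iterate_stepOp (hp : p ∈ Set.Icc (0 : ℝ) 1) (hq : q ∈ Set.Icc (0 : ℝ) 1)
    {g : ℕ → ℝ} (h : MonotoneUnit g) (n : ℕ) : MonotoneUnit ((_root_.stepOp p q)^[n] g) := by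
  induction n with
  | zero => exact h
  | succ n ih =>
    rw [Function.iterate_succ_apply']
    exact ih.stepOp hp hq

theorem MonotoneUnit.servedOp (hp : p ∈ Set.Icc (0 : ℝ) 1) (hq : q ∈ Set.Icc (0 : ℝ) 1)
    {g : ℕ → ℝ} (h : MonotoneUnit g) : MonotoneUnit (servedOp p q g) := by
  obtain ⟨hp0, hp1⟩ := hp
  obtain ⟨hq0, hq1⟩ := hq
  have hp' := sub_nonneg.2 hp1
  have hq' := sub_nonneg.2 hq1
  have hite : ∀ j, (0 : ℝ) ≤ if j = 0 then 0 else g (j - 1) := fun j => by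
    split_ifs
    exacts [le_rfl, h.nonneg _]
  have hite1 : ∀ j, (if j = 0 then 0 else g (j - 1)) ≤ 1 := fun j => by
    split_ifs
    exacts [zero_le_one, h.le_one _]
  refine ⟨fun i j hij => ?_, fun j => ?_, fun j => ?_⟩
  · have h1 := h.monotone hij
    have h2 : (if i = 0 then 0 else g (i - 1)) ≤ if j = 0 then 0 else g (j - 1) := by
      by_cases hi : i = 0
      · rw [if_pos hi]
        exact hite j
      · rw [if_neg hi, if_neg (by omega)]
        exact h.monotone (Nat.sub_le_sub_right hij 1)
    simp only [_root_.servedOp]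
    gcongr
  · exact mul_nonneg hq' (add_nonneg (mul_nonneg hp0 (h.nonneg _)) (mul_nonneg hp' (hite j)))
  · have h1 : p * g j ≤ p * 1 := by gcongr; exact h.le_one j
    have h2 : (1 - p) * (if j = 0 then 0 else g (j - 1)) ≤ (1 - p) * 1 := by gcongr; exact hite1 j
    refine mul_le_one₀ (by linarith) ?_ (by linarith)
    exact add_nonneg (mul_nonneg hp0 (h.nonneg _)) (mul_nonneg hp' (hite j))

/-- From the empty state the queue can only stay or grow, so on monotone functions the iterates at
`0` increase with `n`. -/
theorem MonotoneUnit.exists_tendsto_iterate_stepOp (hp : p ∈ Set.Icc (0 : ℝ) 1)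
    (hq : q ∈ Set.Icc (0 : ℝ) 1) {g : ℕ → ℝ} (h : MonotoneUnit g) :
    ∃ l, Tendsto (fun n => (_root_.stepOp p q)^[n] g 0) atTop (𝓝 l) := by
  refine ⟨_, tendsto_atTop_ciSup (monotone_nat_of_le_succ fun n => ?_)
    ⟨1, by rintro _ ⟨n, rfl⟩; exact (h.iterate_stepOp hp hq n).le_one 0⟩⟩
  rw [Function.iterate_succ_apply']
  have := (h.iterate_stepOp hp hq n).monotone (Nat.zero_le 1)
  have := mul_le_mul_of_nonneg_left this (mul_nonneg hq.1 hp.1)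
  simp only [_root_.stepOp, zero_add, Nat.zero_sub]
  linarith

/-- When upward jumps have positive probability, the one-step equation at `k` can be solved for the
value at `k + 1`, so the limit spreads from state `0` to every state. -/
theorem tendsto_iterate_stepOp {g : ℕ → ℝ} {l : ℝ} (hpq : q * p ≠ 0)
    (h : Tendsto (fun n => (stepOp p q)^[n] g 0) atTop (𝓝 l)) (k : ℕ) :
    Tendsto (fun n => (stepOp p q)^[n] g k) atTop (𝓝 l) := by
  suffices ∀ k, (∀ j ≤ k, Tendsto (fun n => (stepOp p q)^[n] g j) atTop (𝓝 l)) from this k k le_rfl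
  intro k
  induction k with
  | zero =>
    intro j hj
    obtain rfl : j = 0 := by omega
    exact h
  | succ k ih =>
    intro j hj
    rcases hj.lt_or_eq with hj | rfl
    · exact ih j (by omega)
    have h1 := ih k le_rfl
    have h2 := ih (k - 1) (by omega)
    have h3 := h1.comp (tendsto_add_atTop_nat 1)
    have h4 : Tendsto (fun n => ((stepOp p q)^[n + 1] g k - (q * (1 - p) * (stepOp p q)^[n] g k +
        (1 - q) * (p * (stepOp p q)^[n] g k + (1 - p) * (stepOp p q)^[n] g (k - 1)))) / (q * p))
        atTop (𝓝 ((l - (q * (1 - p) * l + (1 - q) * (p * l + (1 - p) * l))) / (q * p))) :=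
      (h3.sub ((h1.const_mul _).add
        (((h1.const_mul _).add (h2.const_mul _)).const_mul _))).div_const _
    convert h4 using 2 with n
    · rw [Function.iterate_succ_apply', eq_div_iff hpq]
      simp only [stepOp]
      ring
    · rw [eq_div_iff hpq]
      ring

/-- Burke's property: under geometric weights, a departure has probability `p` and leaves the law of
the queue length geometric. -/
theorem HasSum.servedOp {ρ : ℝ} (hρ : (1 - q) * (1 - p) * ρ = q * p) {g : ℕ → ℝ} {s : ℝ}
    (h : HasSum (fun j => ρ ^ j * g j) s) :
    HasSum (fun j => ρ ^ j * servedOp p q g j) (p * s) := by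
  have h1 : HasSum (fun j => ρ ^ j * if j = 0 then 0 else g (j - 1)) (ρ * s) := by
    rw [← hasSum_nat_add_iff' 1]
    simpa [pow_succ', mul_assoc] using h.mul_left ρ
  have hs : p * s = (1 - q) * (p * s + (1 - p) * (ρ * s)) := by linear_combination (-s) * hρ
  rw [hs]
  refine (((h.mul_left p).add (h1.mul_left (1 - p))).mul_left (1 - q)).congr_fun fun j => ?_
  simp only [_root_.servedOp]
  ring

theorem HasSum.stepOp {ρ : ℝ} (hρ : (1 - q) * (1 - p) * ρ = q * p) {g : ℕ → ℝ} {s : ℝ}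
    (h : HasSum (fun j => ρ ^ j * g j) s) :
    HasSum (fun j => ρ ^ j * stepOp p q g j) s := by
  have h1 : HasSum (fun j => ρ ^ j * g (j - 1)) (g 0 + ρ * s) := by
    rw [← hasSum_nat_add_iff' 1]
    simpa [pow_succ', mul_assoc] using h.mul_left ρ
  have h2 : HasSum (fun j => ρ ^ (j + 1) * g (j + 1)) (s - g 0) := by
    simpa using (hasSum_nat_add_iff' 1).2 h
  have hs : s = (1 - q) * (1 - p) * (s - g 0) + ((q * (1 - p) + (1 - q) * p) * s +
      (1 - q) * (1 - p) * (g 0 + ρ * s)) := by linear_combination (-s) * hρ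
  rw [hs]
  refine ((h2.mul_left ((1 - q) * (1 - p))).add ((h.mul_left (q * (1 - p) + (1 - q) * p)).add
    (h1.mul_left ((1 - q) * (1 - p))))).congr_fun fun j => ?_
  simp only [_root_.stepOp]
  linear_combination (-ρ ^ j * g (j + 1)) * hρ

theorem HasSum.iterate_stepOp {ρ : ℝ} (hρ : (1 - q) * (1 - p) * ρ = q * p) {g : ℕ → ℝ} {s : ℝ}
    (h : HasSum (fun j => ρ ^ j * g j) s) (n : ℕ) :
    HasSum (fun j => ρ ^ j * (_root_.stepOp p q)^[n] g j) s := by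
  induction n with
  | zero => exact h
  | succ n ih =>
    simp only [Function.iterate_succ_apply']
    exact ih.stepOp hρ

/-- The geometric average is invariant under the iterates, while dominated convergence sends it to
the average of the constant limit; comparing the two identifies that limit. If `q * p = 0`, a queue
started empty never grows. -/
theorem MonotoneUnit.tendsto_iterate_stepOp_of_hasSum (hp : p ∈ Set.Icc (0 : ℝ) 1)
    (hq : q ∈ Set.Icc (0 : ℝ) 1) {ρ : ℝ} (hρ0 : 0 ≤ ρ) (hρ1 : ρ < 1)
    (hpos : 0 < (1 - q) * (1 - p)) (hρ : (1 - q) * (1 - p) * ρ = q * p) {g : ℕ → ℝ} {s : ℝ}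
    (hg : MonotoneUnit g)
    (h : HasSum (fun j => ρ ^ j * g j) s) :
    Tendsto (fun n => (_root_.stepOp p q)^[n] g 0) atTop (𝓝 ((1 - ρ) * s)) := by
  obtain ⟨l, hl⟩ := hg.exists_tendsto_iterate_stepOp hp hq
  by_cases hpq : q * p = 0
  · have hfix : ∀ n, (_root_.stepOp p q)^[n] g 0 = g 0 := by
      intro n
      induction n with
      | zero => rfl
      | succ n ih =>
        rw [Function.iterate_succ_apply', ← ih]
        simp only [_root_.stepOp, zero_add, Nat.zero_sub]
        linear_combination ((_root_.stepOp p q)^[n] g 1 - (_root_.stepOp p q)^[n] g 0) * hpq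
    have hρ' : ρ = 0 := (mul_eq_zero.1 (hρ.trans hpq)).resolve_left hpos.ne'
    have hs : s = g 0 := by
      refine h.unique ?_
      rw [hρ']
      convert hasSum_ite_eq 0 (g 0) using 2 with j
      rcases j with _ | j <;> simp
    simp only [hfix, hρ', hs, sub_zero, one_mul]
    exact tendsto_const_nhds
  · have hlim : Tendsto (fun n => ∑' j, ρ ^ j * (_root_.stepOp p q)^[n] g j) atTop
        (𝓝 (∑' j, ρ ^ j * l)) := by
      refine tendsto_tsum_of_dominated_convergence (summable_geometric_of_lt_one hρ0 hρ1)
        (fun j => (tendsto_iterate_stepOp hpq hl j).const_mul _) (Eventually.of_forall fun n j => ?_)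
      have h1 := (hg.iterate_stepOp hp hq n).le_one j
      have h0 := (hg.iterate_stepOp hp hq n).nonneg j
      rw [Real.norm_of_nonneg (by positivity)]
      exact mul_le_of_le_one_right (by positivity) h1
    simp only [(h.iterate_stepOp hρ _).tsum_eq] at hlim
    rw [tsum_mul_right, tsum_geometric_of_lt_one hρ0 hρ1] at hlim
    have hs := tendsto_nhds_unique hlim tendsto_const_nhds
    convert hl using 2
    have : 1 - ρ ≠ 0 := by linarith
    rw [← hs]
    field_simp

theorem monotoneUnit_indicator (J : ℕ) : MonotoneUnit fun j => if J ≤ j then 1 else 0 := by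
  refine ⟨fun i j hij => ?_, fun j => ?_, fun j => ?_⟩
  · split_ifs <;> first | omega | norm_num
  · split_ifs <;> norm_num
  · split_ifs <;> norm_num

/-- The factor `1 *` and the nesting put the right side in the shape required by two uses of
`iterate_stepOp_comb`. -/
theorem stepOp_indicator (J : ℕ) :
    stepOp p q (fun j => if J + 1 ≤ j then 1 else 0) = fun j =>
      1 * ((q * p) * (if J ≤ j then 1 else 0) +
        (1 - q * p - (1 - q) * (1 - p)) * (if J + 1 ≤ j then 1 else 0)) +
          ((1 - q) * (1 - p)) * (if J + 2 ≤ j then 1 else 0) := by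
  funext j
  simp only [stepOp]
  rcases lt_trichotomy j J with h | rfl | h
  · simp [show ¬ J + 1 ≤ j + 1 by omega, show ¬ J + 1 ≤ j by omega, show ¬ J + 1 ≤ j - 1 by omega,
      show ¬ J ≤ j by omega, show ¬ J + 2 ≤ j by omega]
  · simp [show ¬ j + 1 ≤ j - 1 by omega]
  · obtain rfl | h' := Nat.eq_or_lt_of_le (Nat.succ_le_of_lt h)
    · simp
      ring
    · simp [show J + 1 ≤ j + 1 by omega, show J + 1 ≤ j by omega, show J + 1 ≤ j - 1 by omega,
        show J ≤ j by omega, show J + 2 ≤ j by omega]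
      ring

/-- Let `c J` be the limiting probability that the length is at least `J`. Since upward jumps are at
least as likely as downward ones, the differences `c J - c (J + 1)` are nondecreasing in `J`; as `c`
stays in the unit interval, the first difference must vanish. -/
theorem tendsto_iterate_stepOp_indicator (hp : p ∈ Set.Icc (0 : ℝ) 1) (hq : q ∈ Set.Icc (0 : ℝ) 1)
    (hpos : 0 < (1 - q) * (1 - p)) (hle : (1 - q) * (1 - p) ≤ q * p) :
    Tendsto (fun n => (stepOp p q)^[n] (fun j => if 1 ≤ j then 1 else 0) 0) atTop (𝓝 1) := by
  choose c hc using fun J => (monotoneUnit_indicator J).exists_tendsto_iterate_stepOp hp hq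
  have hc0 : c 0 = 1 := by
    refine tendsto_nhds_unique (hc 0) ?_
    simp only [Nat.zero_le, if_true, iterate_stepOp_one]
    exact tendsto_const_nhds
  have hcnn : ∀ J, 0 ≤ c J := fun J => ge_of_tendsto' (hc J) fun n =>
    ((monotoneUnit_indicator J).iterate_stepOp hp hq n).nonneg 0
  have hanti : ∀ J, c (J + 1) ≤ c J := by
    refine fun J => le_of_tendsto_of_tendsto' (hc (J + 1)) (hc J) fun n => ?_
    refine iterate_stepOp_le hp hq (fun j => ?_) n 0
    split_ifs <;> first | omega | norm_num
  have hrec : ∀ J, c (J + 1) = 1 * ((q * p) * c J +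
      (1 - q * p - (1 - q) * (1 - p)) * c (J + 1)) + ((1 - q) * (1 - p)) * c (J + 2) := by
    intro J
    refine tendsto_nhds_unique ((hc (J + 1)).comp (tendsto_add_atTop_nat 1)) ?_
    simp only [Function.comp_def, Function.iterate_succ_apply, stepOp_indicator,
      iterate_stepOp_comb]
    exact ((((hc J).const_mul _).add ((hc (J + 1)).const_mul _)).const_mul _).add
      ((hc (J + 2)).const_mul _)
  have hd : ∀ J, c 0 - c 1 ≤ c J - c (J + 1) := by
    intro J
    induction J with
    | zero => exact le_rfl
    | succ J ih =>
      refine ih.trans (le_of_mul_le_mul_left ?_ hpos)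
      have := mul_le_mul_of_nonneg_right hle (sub_nonneg.2 (hanti J))
      linarith [hrec J]
  have hsum : ∀ J : ℕ, J * (c 0 - c 1) ≤ c 0 - c J := by
    intro J
    induction J with
    | zero => simp
    | succ J ih =>
      push_cast
      linarith [hd J]
  have hc1 : c 1 = 1 := by
    refine le_antisymm (hc0 ▸ hanti 0) ?_
    by_contra! hlt
    obtain ⟨J, hJ⟩ := exists_nat_gt (1 / (c 0 - c 1))
    rw [div_lt_iff₀ (by linarith)] at hJ
    linarith [hsum J, hcnn J]
  exact hc1 ▸ hc 1

theorem tendsto_iterate_stepOp_servedOp_one (hp : p ∈ Set.Icc (0 : ℝ) 1)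
    (hq : q ∈ Set.Icc (0 : ℝ) 1) (hpq : 1 ≤ p + q) :
    Tendsto (fun n => (stepOp p q)^[n] (servedOp p q fun _ => 1) 0) atTop (𝓝 (1 - q)) := by
  have hserved : (servedOp p q fun _ => 1) = fun j => ((1 - q) * p) * (fun _ => 1 : ℕ → ℝ) j +
      ((1 - q) * (1 - p)) * (fun j => if 1 ≤ j then 1 else 0 : ℕ → ℝ) j := by
    funext j
    rcases j with _ | j
    · simp [servedOp]
    · simp only [servedOp, Nat.succ_ne_zero, if_false, Nat.le_add_left, if_true]
      ring
  rw [hserved]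
  simp only [iterate_stepOp_comb (p := p) (q := q) ((1 - q) * p), iterate_stepOp_one]
  rcases (mul_nonneg (sub_nonneg.2 hq.2) (sub_nonneg.2 hp.2)).eq_or_lt with h0 | hpos
  · simp only [← h0, zero_mul, add_zero, mul_one]
    convert tendsto_const_nhds using 2
    linarith
  · have h := tendsto_iterate_stepOp_indicator hp hq hpos (by linarith)
    convert (h.const_mul ((1 - q) * (1 - p))).const_add ((1 - q) * p * 1) using 2
    ring

/-- The composition of the operators for the positions `v + n - 1, …, v + 1, v`, where departures
are required at the positions in `I`. -/
def windowOp (p q : ℝ) (I : Finset ℤ) : ℕ → ℤ → (ℕ → ℝ) → ℕ → ℝ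
  | 0, _, g => g
  | n + 1, v, g => windowOp p q I n (v + 1) (if v ∈ I then servedOp p q g else stepOp p q g)

variable {I : Finset ℤ}

theorem windowOp_add (m n : ℕ) (v : ℤ) (g : ℕ → ℝ) :
    windowOp p q I (m + n) v g = windowOp p q I n (v + m) (windowOp p q I m v g) := by
  induction m generalizing v g with
  | zero => simp [windowOp]
  | succ m ih =>
    rw [Nat.add_right_comm, windowOp, windowOp, ih, Nat.cast_succ, add_assoc, add_comm (1 : ℤ)]

theorem windowOp_eq_iterate {v : ℤ} (h : ∀ i ∈ I, i < v) (n : ℕ) (g : ℕ → ℝ) :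
    windowOp p q I n v g = (stepOp p q)^[n] g := by
  induction n generalizing v g with
  | zero => rfl
  | succ n ih =>
    rw [windowOp, if_neg (fun hv => (h v hv).false), ih fun i hi => (h i hi).trans (lt_add_one v)]
    rfl

theorem MonotoneUnit.windowOp (hp : p ∈ Set.Icc (0 : ℝ) 1) (hq : q ∈ Set.Icc (0 : ℝ) 1)
    {g : ℕ → ℝ} (h : MonotoneUnit g) (n : ℕ) (v : ℤ) : MonotoneUnit (windowOp p q I n v g) := by
  induction n generalizing v g with
  | zero => exact h
  | succ n ih =>
    rw [_root_.windowOp]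
    apply ih
    split_ifs
    exacts [h.servedOp hp hq, h.stepOp hp hq]

theorem HasSum.windowOp {ρ : ℝ} (hρ : (1 - q) * (1 - p) * ρ = q * p) {g : ℕ → ℝ} {s : ℝ}
    (h : HasSum (fun j => ρ ^ j * g j) s) (n : ℕ) (v : ℤ) :
    HasSum (fun j => ρ ^ j * windowOp p q I n v g j)
      (p ^ (I.filter fun i => v ≤ i ∧ i < v + n).card * s) := by
  induction n generalizing v g s with
  | zero =>
    have : (I.filter fun i => v ≤ i ∧ i < v + (0 : ℕ)) = ∅ :=
      Finset.filter_eq_empty_iff.2 fun i _ => by omega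
    simpa only [this, Finset.card_empty, pow_zero, one_mul, _root_.windowOp] using h
  | succ n ih =>
    simp only [_root_.windowOp]
    by_cases hv : v ∈ I
    · have hI : (I.filter fun i => v ≤ i ∧ i < v + (n + 1 : ℕ)) =
          insert v (I.filter fun i => v + 1 ≤ i ∧ i < v + 1 + n) := by
        ext i
        simp only [Finset.mem_filter, Finset.mem_insert]
        constructor
        · rintro ⟨hi, h1, h2⟩
          by_cases hiv : i = v
          · exact Or.inl hiv
          · exact Or.inr ⟨hi, by omega, by push_cast at h2; omega⟩
        · rintro (rfl | ⟨hi, h1, h2⟩)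
          · exact ⟨hv, le_rfl, by push_cast; omega⟩
          · exact ⟨hi, by omega, by push_cast; omega⟩
      rw [hI, Finset.card_insert_of_notMem (by simp), pow_succ, mul_assoc]
      simp only [hv, if_true]
      exact ih (h.servedOp hρ) (v + 1)
    · have hI : (I.filter fun i => v ≤ i ∧ i < v + (n + 1 : ℕ)) =
          (I.filter fun i => v + 1 ≤ i ∧ i < v + 1 + n) := by
        refine Finset.filter_congr fun i hi => ?_
        have : i ≠ v := by rintro rfl; exact hv hi
        push_cast
        omega
      rw [hI]
      simp only [hv, if_false]
      exact ih (h.stepOp hρ) (v + 1)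

theorem monotoneUnit_one : MonotoneUnit fun _ => 1 :=
  ⟨monotone_const, fun _ => zero_le_one, fun _ => le_rfl⟩

theorem tendsto_windowOp_of_add_lt_one (hp : p ∈ Set.Icc (0 : ℝ) 1) (hq : q ∈ Set.Icc (0 : ℝ) 1)
    (hpq : p + q < 1) {m : ℕ} {v : ℤ} (hI : ∀ i ∈ I, v ≤ i ∧ i < v + m) :
    Tendsto (fun n => windowOp p q I (m + n) v (fun _ => 1) 0) atTop (𝓝 (p ^ I.card)) := by
  have hpos : 0 < (1 - q) * (1 - p) := mul_pos (by linarith [hp.1]) (by linarith [hq.1])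
  have hρ0 : 0 ≤ q * p / ((1 - q) * (1 - p)) := div_nonneg (mul_nonneg hq.1 hp.1) hpos.le
  have hρ1 : q * p / ((1 - q) * (1 - p)) < 1 := by
    rw [div_lt_one hpos]
    linarith
  have hρ := mul_div_cancel₀ (q * p) hpos.ne'
  set ρ := q * p / ((1 - q) * (1 - p))
  simp only [windowOp_add, windowOp_eq_iterate fun i hi => (hI i hi).2]
  have h := HasSum.windowOp (I := I) (g := fun _ => 1) hρ
    (by simpa using hasSum_geometric_of_lt_one hρ0 hρ1) m v
  rw [Finset.filter_true_of_mem hI] at h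
  convert (monotoneUnit_one.windowOp hp hq m v).tendsto_iterate_stepOp_of_hasSum hp hq hρ0 hρ1
    hpos hρ h using 2
  have : 1 - ρ ≠ 0 := by linarith
  field_simp

theorem tendsto_windowOp_singleton (hp : p ∈ Set.Icc (0 : ℝ) 1) (hq : q ∈ Set.Icc (0 : ℝ) 1)
    (hpq : 1 ≤ p + q) (v : ℤ) :
    Tendsto (fun n => windowOp p q {v} (1 + n) v (fun _ => 1) 0) atTop (𝓝 (1 - q)) := by
  have h : ∀ i ∈ ({v} : Finset ℤ), i < v + (1 : ℕ) := by simp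
  simp only [windowOp_add, windowOp_eq_iterate h]
  simpa [windowOp] using tendsto_iterate_stepOp_servedOp_one hp hq hpq

end Operators

/-! ### On the line: Bernoulli input and the limiting law. -/

section LineLaw

open scoped Topology ENNReal
open Filter

theorem measurableSet_superset {ι : Type*} (I : Finset ι) :
    MeasurableSet {A : Set ι | ∀ i ∈ I, i ∈ A} := by
  have : {A : Set ι | ∀ i ∈ I, i ∈ A} = ⋂ i ∈ I, {A | i ∈ A} := by
    ext
    simp
  rw [this]
  exact Finset.measurableSet_biInter _ fun i _ => measurableSet_mem i

/-- The events of containing a given finite set are closed under intersection and generate the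
σ-algebra. -/
theorem ext_of_superset {ι : Type*} {μ ν : Measure (Set ι)} [IsFiniteMeasure μ]
    (h : ∀ I : Finset ι, μ {A | ∀ i ∈ I, i ∈ A} = ν {A | ∀ i ∈ I, i ∈ A}) : μ = ν := by
  classical
  refine ext_of_generate_finite (Set.range fun I : Finset ι => {A : Set ι | ∀ i ∈ I, i ∈ A}) ?_ ?_
    ?_ (by simpa using h ∅)
  · refine le_antisymm (fun A hA => ?_) (MeasurableSpace.generateFrom_le ?_)
    · refine (@measurable_set_iff ι (Set ι) (MeasurableSpace.generateFrom _) id).2 (fun i => ?_) hA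
      refine @measurable_to_prop _ (_) _ ?_
      refine MeasurableSpace.measurableSet_generateFrom ⟨{i}, ?_⟩
      ext
      simp
    · rintro _ ⟨I, rfl⟩
      exact measurableSet_superset I
  · rintro _ ⟨I, rfl⟩ _ ⟨J, rfl⟩ -
    refine ⟨I ∪ J, ?_⟩
    ext A
    simp only [Finset.mem_union, or_imp, forall_and, Set.mem_inter_iff, Set.mem_ofPred_eq]
  · rintro _ ⟨I, rfl⟩
    exact h I

variable {ι : Type*}

theorem setBernoulli_superset (p : unitInterval) (s : Finset ι) :
    setBernoulli Set.univ p {A : Set ι | ∀ i ∈ s, i ∈ A} =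
      (unitInterval.toNNReal p : ℝ≥0∞) ^ s.card := by
  rw [setBernoulli_apply']
  have : ((fun p : ι → Prop => {i | p i}) ⁻¹' {A : Set ι | ∀ i ∈ s, i ∈ A}) =
      Set.pi s fun _ => {True} := by
    ext
    simp [Set.mem_pi]
  rw [this, Measure.infinitePi_pi _ fun _ _ => .of_discrete, ← Finset.prod_const]
  refine Finset.prod_congr rfl fun i _ => ?_
  simp

theorem setBernoulli_disjoint (p : unitInterval) (s : Finset ι) :
    setBernoulli Set.univ p {A : Set ι | ∀ i ∈ s, i ∉ A} =
      (unitInterval.toNNReal (unitInterval.symm p) : ℝ≥0∞) ^ s.card := by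
  rw [setBernoulli_apply']
  have : ((fun p : ι → Prop => {i | p i}) ⁻¹' {A : Set ι | ∀ i ∈ s, i ∉ A}) =
      Set.pi s fun _ => {False} := by
    ext
    simp [Set.mem_pi]
  rw [this, Measure.infinitePi_pi _ fun _ _ => .of_discrete, ← Finset.prod_const]
  refine Finset.prod_congr rfl fun i _ => ?_
  simp

theorem toNNReal_add_toNNReal_symm (p : unitInterval) :
    (unitInterval.toNNReal p : ℝ≥0∞) + (unitInterval.toNNReal (unitInterval.symm p) : ℝ≥0∞) = 1 := by
  rw [← ENNReal.coe_add, ← ENNReal.coe_one, ENNReal.coe_inj]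
  ext
  simp

theorem measurable_insert_set (u : ι) : Measurable fun A : Set ι => insert u A := by
  refine measurable_set_iff.2 fun i => ?_
  by_cases h : i = u
  · simp [h]
  · simpa [h] using measurable_set_mem i

theorem measurable_sdiff_singleton (u : ι) : Measurable fun A : Set ι => A \ {u} := by
  refine measurable_set_iff.2 fun i => ?_
  by_cases h : i = u
  · simp [h]
  · simpa [h] using measurable_set_mem i

/-- Redrawing the membership of `u` independently does not change the law; this replaces
conditioning on one coordinate. -/
theorem setBernoulli_eq_resample (p : unitInterval) (u : ι) :
    setBernoulli Set.univ p =
      (unitInterval.toNNReal p : ℝ≥0∞) • (setBernoulli Set.univ p).map (insert u) +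
      (unitInterval.toNNReal (unitInterval.symm p) : ℝ≥0∞) •
        (setBernoulli Set.univ p).map (· \ {u}) := by
  classical
  refine ext_of_superset fun s => ?_
  rw [Measure.add_apply, Measure.smul_apply, Measure.smul_apply,
    Measure.map_apply (measurable_insert_set u) (measurableSet_superset s),
    Measure.map_apply (measurable_sdiff_singleton u) (measurableSet_superset s),
    setBernoulli_superset]
  have h1 : insert u ⁻¹' {A : Set ι | ∀ i ∈ s, i ∈ A} = {A | ∀ i ∈ s.erase u, i ∈ A} := by
    ext A
    simp only [Set.mem_preimage, Set.mem_ofPred_eq, Set.mem_insert_iff, Finset.mem_erase]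
    refine forall_congr' fun i => ?_
    tauto
  rw [h1, setBernoulli_superset, smul_eq_mul, smul_eq_mul]
  by_cases hu : u ∈ s
  · have h2 : (· \ {u}) ⁻¹' {A : Set ι | ∀ i ∈ s, i ∈ A} = ∅ := by
      ext A
      simp only [Set.mem_preimage, Set.mem_ofPred_eq, Set.mem_empty_iff_false, iff_false]
      exact fun h => (h u hu).2 rfl
    rw [h2, measure_empty, mul_zero, add_zero, ← pow_succ', Finset.card_erase_add_one hu]
  · have h2 : (· \ {u}) ⁻¹' {A : Set ι | ∀ i ∈ s, i ∈ A} = {A | ∀ i ∈ s, i ∈ A} := by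
      ext A
      simp only [Set.mem_preimage, Set.mem_ofPred_eq, Set.mem_sdiff, Set.mem_singleton_iff]
      refine forall_congr' fun i => forall_congr' fun hi => ?_
      have : i ≠ u := by rintro rfl; exact hu hi
      tauto
    rw [h2, setBernoulli_superset, Finset.erase_eq_of_notMem hu, ← add_mul,
      toNNReal_add_toNNReal_symm, one_mul]

theorem integral_eq_of_eq_add_map {α : Type*} [MeasurableSpace α] {μ : Measure α}
    [IsFiniteMeasure μ] {φ ψ : α → α} (hφ : Measurable φ) (hψ : Measurable ψ) {p : unitInterval}
    (h : μ = (unitInterval.toNNReal p : ℝ≥0∞) • μ.map φ +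
      (unitInterval.toNNReal (unitInterval.symm p) : ℝ≥0∞) • μ.map ψ)
    {f : α → ℝ} (hf : Measurable f) {C : ℝ} (hC : ∀ x, |f x| ≤ C) :
    ∫ x, f x ∂μ = ∫ x, ((p : ℝ) * f (φ x) + (1 - p) * f (ψ x)) ∂μ := by
  have hint : ∀ (ν : Measure α) [IsFiniteMeasure ν], Integrable f ν := fun ν _ =>
    .of_bound hf.aestronglyMeasurable C (Eventually.of_forall hC)
  have hint' : ∀ χ : α → α, Measurable χ → Integrable (fun x => f (χ x)) μ := fun χ hχ =>
    .of_bound (hf.comp hχ).aestronglyMeasurable C (Eventually.of_forall fun x => hC _)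
  conv_lhs => rw [h]
  rw [integral_add_measure ((hint _).smul_measure ENNReal.coe_ne_top)
    ((hint _).smul_measure ENNReal.coe_ne_top), integral_smul_measure, integral_smul_measure,
    integral_map hφ.aemeasurable hf.aestronglyMeasurable,
    integral_map hψ.aemeasurable hf.aestronglyMeasurable,
    integral_add ((hint' φ hφ).const_mul _) ((hint' ψ hψ).const_mul _), integral_const_mul,
    integral_const_mul]
  simp

theorem integral_prod_setBernoulli_resample (p q : unitInterval) (u : ι) {f : Set ι × Set ι → ℝ}
    (hf : Measurable f) {C : ℝ} (hC : ∀ x, |f x| ≤ C) :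
    ∫ z, f z ∂(setBernoulli Set.univ p).prod (setBernoulli Set.univ q) =
      ∫ z, ((p : ℝ) * (q * f (insert u z.1, insert u z.2) + (1 - q) * f (insert u z.1, z.2 \ {u})) +
        (1 - p) * (q * f (z.1 \ {u}, insert u z.2) + (1 - q) * f (z.1 \ {u}, z.2 \ {u})))
        ∂(setBernoulli Set.univ p).prod (setBernoulli Set.univ q) := by
  set μ := setBernoulli (Set.univ : Set ι) p with hμ
  set ν := setBernoulli (Set.univ : Set ι) q with hν
  have hi := measurable_insert_set u
  have hs := measurable_sdiff_singleton u
  have h1 : μ.prod ν = (unitInterval.toNNReal p : ℝ≥0∞) • (μ.prod ν).map (Prod.map (insert u) id) +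
      (unitInterval.toNNReal (unitInterval.symm p) : ℝ≥0∞) •
        (μ.prod ν).map (Prod.map (· \ {u}) id) := by
    rw [← Measure.map_prod_map _ _ hi measurable_id, ← Measure.map_prod_map _ _ hs measurable_id,
      Measure.map_id, ← Measure.prod_smul_left, ← Measure.prod_smul_left, ← Measure.add_prod,
      hμ, ← setBernoulli_eq_resample p u]
  have h2 : μ.prod ν = (unitInterval.toNNReal q : ℝ≥0∞) • (μ.prod ν).map (Prod.map id (insert u)) +
      (unitInterval.toNNReal (unitInterval.symm q) : ℝ≥0∞) •
        (μ.prod ν).map (Prod.map id (· \ {u})) := by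
    rw [← Measure.map_prod_map _ _ measurable_id hi, ← Measure.map_prod_map _ _ measurable_id hs,
      Measure.map_id, ← Measure.prod_smul_right, ← Measure.prod_smul_right, ← Measure.prod_add,
      hν, ← setBernoulli_eq_resample q u]
  have hfi : Measurable fun z => f (Prod.map id (insert u) z) := hf.comp (measurable_id.prodMap hi)
  have hfs : Measurable fun z => f (Prod.map id (· \ {u}) z) := hf.comp (measurable_id.prodMap hs)
  rw [integral_eq_of_eq_add_map (measurable_id.prodMap hi) (measurable_id.prodMap hs) h2 hf hC,
    integral_eq_of_eq_add_map (hi.prodMap measurable_id) (hs.prodMap measurable_id) h1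
      (f := fun z => (q : ℝ) * f (Prod.map id (insert u) z) +
        (1 - q) * f (Prod.map id (· \ {u}) z))
      ((hfi.const_mul _).add (hfs.const_mul _)) (C := C)]
  · rfl
  · intro x
    have hq0 := q.2.1
    have hq1 := sub_nonneg.2 q.2.2
    refine (abs_add_le _ _).trans ?_
    rw [abs_mul, abs_mul, abs_of_nonneg hq0, abs_of_nonneg hq1]
    have h3 := mul_le_mul_of_nonneg_left (hC (Prod.map id (insert u) x)) hq0
    have h4 := mul_le_mul_of_nonneg_left (hC (Prod.map id (· \ {u}) x)) hq1
    linarith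

theorem queueLength_congr {S S' T T' : Set ℤ} (n : ℕ) {v : ℤ} (hS : ∀ i, v ≤ i → (i ∈ S ↔ i ∈ S'))
    (hT : ∀ i, v ≤ i → (i ∈ T ↔ i ∈ T')) : queueLength S T n v = queueLength S' T' n v := by
  classical
  induction n generalizing v with
  | zero => rfl
  | succ n ih =>
    rw [queueLength, queueLength, ih (fun i hi => hS i (by omega)) (fun i hi => hT i (by omega)),
      if_congr (hS v le_rfl) rfl rfl, if_congr (hT v le_rfl) rfl rfl]

theorem servedWithin_congr {S S' T T' : Set ℤ} (n : ℕ) {v : ℤ}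
    (hS : ∀ i, v ≤ i → (i ∈ S ↔ i ∈ S')) (hT : ∀ i, v ≤ i → (i ∈ T ↔ i ∈ T')) :
    ServedWithin S T n v ↔ ServedWithin S' T' n v := by
  classical
  rw [ServedWithin, ServedWithin, queueLength_congr n (fun i hi => hS i (by omega))
    (fun i hi => hT i (by omega)), if_congr (hS v le_rfl) rfl rfl, hT v le_rfl]

/-- Each position in `s` from `v` to `v + n - 1` serves a customer in the queue that starts at
position `v + n`. -/
def DepartsWithin (s : Finset ℤ) (S T : Set ℤ) : ℕ → ℤ → Prop
  | 0, _ => True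
  | n + 1, v => DepartsWithin s S T n (v + 1) ∧ (v ∈ s → ServedWithin S T n v)

theorem departsWithin_congr {s : Finset ℤ} {S S' T T' : Set ℤ} (n : ℕ) {v : ℤ}
    (hS : ∀ i, v ≤ i → (i ∈ S ↔ i ∈ S')) (hT : ∀ i, v ≤ i → (i ∈ T ↔ i ∈ T')) :
    DepartsWithin s S T n v ↔ DepartsWithin s S' T' n v := by
  induction n generalizing v with
  | zero => rfl
  | succ n ih =>
    rw [DepartsWithin, DepartsWithin, servedWithin_congr n hS hT,
      ih (fun i hi => hS i (by omega)) (fun i hi => hT i (by omega))]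

theorem measurable_queueLength (n : ℕ) (v : ℤ) :
    Measurable fun z : Set ℤ × Set ℤ => queueLength z.1 z.2 n v := by
  induction n generalizing v with
  | zero => exact measurable_const
  | succ n ih =>
    have h1 : MeasurableSet {z : Set ℤ × Set ℤ | v ∈ z.1} := measurable_fst (measurableSet_mem v)
    have h2 : MeasurableSet {z : Set ℤ × Set ℤ | v ∈ z.2} := measurable_snd (measurableSet_mem v)
    exact ((ih (v + 1)).add (.ite h1 measurable_const measurable_const)).sub
      (.ite h2 measurable_const measurable_const)

theorem measurableSet_servedWithin (n : ℕ) (v : ℤ) :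
    MeasurableSet {z : Set ℤ × Set ℤ | ServedWithin z.1 z.2 n v} := by
  have h1 : MeasurableSet {z : Set ℤ × Set ℤ | v ∈ z.1} := measurable_fst (measurableSet_mem v)
  have h2 : MeasurableSet {z : Set ℤ × Set ℤ | v ∉ z.2} := measurable_snd (measurableSet_notMem v)
  exact h2.inter (measurableSet_le measurable_const
    ((measurable_queueLength n (v + 1)).add (.ite h1 measurable_const measurable_const)))

theorem measurableSet_departsWithin (s : Finset ℤ) (n : ℕ) (v : ℤ) :
    MeasurableSet {z : Set ℤ × Set ℤ | DepartsWithin s z.1 z.2 n v} := by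
  induction n generalizing v with
  | zero => exact .univ
  | succ n ih =>
    have h : MeasurableSet {z : Set ℤ × Set ℤ | v ∈ s → ServedWithin z.1 z.2 n v} := by
      by_cases hv : v ∈ s
      · simpa only [hv, true_imp_iff] using measurableSet_servedWithin n v
      · simp [hv]
    exact (ih (v + 1)).inter h

-- Resample `v` in both sets. The queue up to `v + 1` ignores that coordinate, so averaging over its
-- four outcomes produces exactly one transition operator.
open Classical in
theorem integral_departsWithin (p q : unitInterval) (s : Finset ℤ) (n : ℕ) (v : ℤ) {g : ℕ → ℝ}
    (hg : MonotoneUnit g) :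
    ∫ z, (if DepartsWithin s z.1 z.2 n v then g (queueLength z.1 z.2 n v) else 0)
      ∂(setBernoulli Set.univ p).prod (setBernoulli Set.univ q) = windowOp p q s n v g 0 := by
  induction n generalizing v g with
  | zero => simp [DepartsWithin, queueLength, windowOp]
  | succ n ih =>
    have hg' : MonotoneUnit (if v ∈ s then servedOp p q g else stepOp p q g) := by
      split_ifs
      exacts [hg.servedOp p.2 q.2, hg.stepOp p.2 q.2]
    rw [windowOp, ← ih (v + 1) hg', integral_prod_setBernoulli_resample p q v (C := 1)]
    · refine integral_congr_ae (Eventually.of_forall fun z => ?_)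
      have hins : ∀ (A : Set ℤ) i, v + 1 ≤ i → (i ∈ insert v A ↔ i ∈ A) := by
        intro A i hi
        simp [show i ≠ v by omega]
      have hdel : ∀ (A : Set ℤ) i, v + 1 ≤ i → (i ∈ A \ {v} ↔ i ∈ A) := by
        intro A i hi
        simp [show i ≠ v by omega]
      simp only [DepartsWithin, queueLength, ServedWithin,
        queueLength_congr n (hins z.1) (hins z.2), queueLength_congr n (hins z.1) (hdel z.2),
        queueLength_congr n (hdel z.1) (hins z.2), queueLength_congr n (hdel z.1) (hdel z.2),
        departsWithin_congr n (hins z.1) (hins z.2), departsWithin_congr n (hins z.1) (hdel z.2),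
        departsWithin_congr n (hdel z.1) (hins z.2), departsWithin_congr n (hdel z.1) (hdel z.2)]
      generalize queueLength z.1 z.2 n (v + 1) = j
      by_cases hD : DepartsWithin s z.1 z.2 n (v + 1)
      · by_cases hv : v ∈ s
        · rcases j with _ | j
          · simp [hD, hv, servedOp]
            ring
          · simp [hD, hv, servedOp]
            ring
        · simp [hD, hv, stepOp]
          ring
      · simp [hD]
    · exact .ite (measurableSet_departsWithin s _ v)
        ((measurable_from_nat (f := g)).comp (measurable_queueLength _ v)) measurable_const
    · intro z
      split_ifs
      · rw [abs_of_nonneg (hg.nonneg _)]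
        exact hg.le_one _
      · simp

theorem queueLength_le_succ (S T : Set ℤ) (n : ℕ) (v : ℤ) :
    queueLength S T n v ≤ queueLength S T (n + 1) v := by
  induction n generalizing v with
  | zero => exact Nat.zero_le _
  | succ n ih =>
    rw [queueLength, queueLength.eq_def S T (n + 1 + 1)]
    exact Nat.sub_le_sub_right (Nat.add_le_add_right (ih (v + 1)) _) _

theorem ServedWithin.mono {S T : Set ℤ} {m n : ℕ} (hmn : m ≤ n) {v : ℤ}
    (h : ServedWithin S T m v) : ServedWithin S T n v :=
  ⟨h.1, h.2.trans (Nat.add_le_add_right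
    (monotone_nat_of_le_succ (fun n => queueLength_le_succ S T n (v + 1)) hmn) _)⟩

theorem departsWithin_iff {s : Finset ℤ} {S T : Set ℤ} {n : ℕ} {v : ℤ} :
    DepartsWithin s S T n v ↔
      ∀ i ∈ s, ∀ k : ℕ, v ≤ i → i + k + 1 = v + n → ServedWithin S T k i := by
  induction n generalizing v with
  | zero =>
    refine iff_of_true trivial fun i _ k h1 h2 => ?_
    omega
  | succ n ih =>
    rw [DepartsWithin, ih]
    constructor
    · rintro ⟨h1, h2⟩ i hi k hk hk'
      by_cases hiv : i = v
      · subst hiv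
        obtain rfl : k = n := by omega
        exact h2 hi
      · exact h1 i hi k (by omega) (by omega)
    · intro h
      exact ⟨fun i hi k h1 h2 => h i hi k (by omega) (by omega),
        fun hv => h v hv n le_rfl (by omega)⟩

/-- Starting the empty queue further right only adds departures, so the window events increase to
the limiting event and continuity from below applies. -/
theorem tendsto_windowOp_measure (p q : unitInterval) {s : Finset ℤ} {m : ℕ} {v : ℤ}
    (hs : ∀ i ∈ s, v ≤ i ∧ i < v + m) :
    Tendsto (fun n => windowOp p q s (m + n) v (fun _ => 1) 0) atTop
      (𝓝 (((setBernoulli Set.univ p).prod (setBernoulli Set.univ q)).real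
        {z | ∀ i ∈ s, ∃ n, ServedWithin z.1 z.2 n i})) := by
  classical
  set M := (setBernoulli (Set.univ : Set ℤ) p).prod (setBernoulli (Set.univ : Set ℤ) q)
  have hmono : Monotone fun n => {z : Set ℤ × Set ℤ | DepartsWithin s z.1 z.2 (m + n) v} := by
    intro n n' hn z hz
    rw [Set.mem_ofPred_eq, departsWithin_iff] at hz ⊢
    intro i hi k h1 h2
    -- The smaller window starts `n' - n` positions closer to `i`; since `i < v + m`, the
    -- subtraction does not truncate.
    exact (hz i hi (k - (n' - n)) h1 (by have := (hs i hi).2; omega)).mono (Nat.sub_le _ _)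
  have hunion : {z : Set ℤ × Set ℤ | ∀ i ∈ s, ∃ n, ServedWithin z.1 z.2 n i} =
      ⋃ n, {z | DepartsWithin s z.1 z.2 (m + n) v} := by
    ext z
    simp only [Set.mem_iUnion, Set.mem_ofPred_eq, departsWithin_iff]
    constructor
    · intro h
      choose! f hf using h
      refine ⟨s.sup f, fun i hi k h1 h2 => (hf i hi).mono ?_⟩
      have := Finset.le_sup (f := f) hi
      have := (hs i hi).2
      omega
    · rintro ⟨n, h⟩ i hi
      obtain ⟨h1, h2⟩ := hs i hi
      exact ⟨(v + m + n - 1 - i).toNat, h i hi _ h1 (by omega)⟩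
  rw [hunion]
  have := (ENNReal.tendsto_toReal (measure_ne_top M _)).comp (tendsto_measure_iUnion_atTop hmono)
  refine this.congr fun n => ?_
  rw [← integral_departsWithin p q s _ v monotoneUnit_one]
  simp only [Function.comp_apply]
  rw [← measureReal_def, ← integral_indicator_one (measurableSet_departsWithin s _ v)]
  rfl

/-- The limiting set of positions that serve a customer. -/
def servedPositions (z : Set ℤ × Set ℤ) : Set ℤ := {v | ∃ n, ServedWithin z.1 z.2 n v}

theorem measurable_servedPositions : Measurable servedPositions := by
  refine measurable_set_iff.2 fun v => measurableSet_setOfPred.1 ?_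
  have : {z | v ∈ servedPositions z} = ⋃ n, {z | ServedWithin z.1 z.2 n v} := by
    ext z
    simp [servedPositions]
  rw [this]
  exact .iUnion fun n => measurableSet_servedWithin n v

theorem hasLaw_servedPositions_of_add_lt_one (p q : unitInterval) (hpq : (p : ℝ) + q < 1) :
    HasLaw servedPositions (setBernoulli Set.univ p)
      ((setBernoulli Set.univ p).prod (setBernoulli Set.univ q)) := by
  have hmeas := measurable_servedPositions
  refine ⟨hmeas.aemeasurable, ?_⟩
  have := Measure.isProbabilityMeasure_map (μ := (setBernoulli (Set.univ : Set ℤ) p).prod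
    (setBernoulli (Set.univ : Set ℤ) q)) hmeas.aemeasurable
  refine ext_of_superset fun s => ?_
  rw [Measure.map_apply hmeas (measurableSet_superset s), setBernoulli_superset]
  obtain ⟨v, w, hvw⟩ : ∃ v w : ℤ, ∀ i ∈ s, v ≤ i ∧ i < w := by
    obtain ⟨v, hv⟩ := s.bddBelow
    obtain ⟨w, hw⟩ := s.bddAbove
    exact ⟨v, w + 1, fun i hi => ⟨hv hi, Int.lt_add_one_iff.2 (hw hi)⟩⟩
  have hs : ∀ i ∈ s, v ≤ i ∧ i < v + (w - v).toNat := fun i hi => by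
    have := hvw i hi
    omega
  have h := tendsto_nhds_unique (tendsto_windowOp_measure p q hs)
    (tendsto_windowOp_of_add_lt_one p.2 q.2 hpq hs)
  rw [← ENNReal.toReal_eq_toReal_iff' (measure_ne_top _ _) (by simp), ENNReal.toReal_pow]
  exact h.trans (by simp)

theorem hasLaw_servedPositions_of_one_le_add (p q : unitInterval) (hpq : 1 ≤ (p : ℝ) + q) :
    HasLaw servedPositions (setBernoulli Set.univ (unitInterval.symm q))
      ((setBernoulli Set.univ p).prod (setBernoulli Set.univ q)) := by
  set M := (setBernoulli (Set.univ : Set ℤ) p).prod (setBernoulli (Set.univ : Set ℤ) q) with hM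
  have hcompl : HasLaw (fun z : Set ℤ × Set ℤ => z.2ᶜ)
      (setBernoulli Set.univ (unitInterval.symm q)) M := by
    have hmeas : Measurable fun z : Set ℤ × Set ℤ => z.2ᶜ := measurable_compl.comp measurable_snd
    refine ⟨hmeas.aemeasurable, ?_⟩
    have := Measure.isProbabilityMeasure_map (μ := M) hmeas.aemeasurable
    refine ext_of_superset fun s => ?_
    rw [Measure.map_apply hmeas (measurableSet_superset s), setBernoulli_superset,
      ← setBernoulli_disjoint]
    have : (fun z : Set ℤ × Set ℤ => z.2ᶜ) ⁻¹' {A | ∀ i ∈ s, i ∈ A} =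
        Set.univ ×ˢ {A | ∀ i ∈ s, i ∉ A} := by
      ext z
      simp
    rw [this, hM, Measure.prod_prod, measure_univ, one_mul]
  refine hcompl.congr ?_
  have hae : ∀ v : ℤ, ∀ᵐ z ∂M, v ∈ servedPositions z ↔ v ∈ z.2ᶜ := by
    intro v
    have hmeasv : MeasurableSet {z | v ∈ servedPositions z} :=
      measurable_servedPositions (measurableSet_mem v)
    have h := tendsto_nhds_unique (tendsto_windowOp_measure p q (s := {v}) (m := 1) (v := v)
      (by simp)) (tendsto_windowOp_singleton p.2 q.2 hpq v)
    have h1 : M {z | v ∈ servedPositions z} =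
        (unitInterval.toNNReal (unitInterval.symm q) : ℝ≥0∞) := by
      rw [← ENNReal.toReal_eq_toReal_iff' (measure_ne_top _ _) (by simp)]
      simpa [servedPositions, measureReal_def] using h
    have h2 : M {z | v ∈ z.2ᶜ} = (unitInterval.toNNReal (unitInterval.symm q) : ℝ≥0∞) := by
      have := setBernoulli_superset (unitInterval.symm q) {v}
      rw [← hcompl.map_eq, Measure.map_apply_of_aemeasurable hcompl.aemeasurable
        (measurableSet_superset _)] at this
      simpa using this
    -- Used services lie among the offered ones and have the same probability `1 - q`, so the two
    -- events agree almost surely, and countability of `ℤ` then gives equality of the sets.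
    have h3 := ae_eq_of_subset_of_measure_ge
      (fun z (hz : v ∈ servedPositions z) => (hz.choose_spec.1 : v ∈ z.2ᶜ)) (h2.trans h1.symm).le
      hmeasv.nullMeasurableSet (measure_ne_top M _)
    filter_upwards [h3] with z hz
    exact iff_of_eq hz
  filter_upwards [ae_all_iff.2 hae] with z hz
  exact Set.ext hz

theorem hasLaw_particlePositions_line {Ω : Type*} [MeasurableSpace Ω] (P : Measure Ω)
    [IsProbabilityMeasure P] (p q : unitInterval) (S T : Ω → Set ℤ) (x : Ω → ℤ → Site)
    (hS : HasLaw S (setBernoulli Set.univ p) P) (hT : HasLaw T (setBernoulli Set.univ q) P)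
    (hST : IndepFun S T P) (hx : ∀ᵐ ω ∂P, CollapsesTo (S ω) (T ω) (x ω)) :
    HasLaw (fun ω => particlePositions (x ω))
      (setBernoulli Set.univ (min p (unitInterval.symm q))) P := by
  have hlaw : HasLaw servedPositions (setBernoulli Set.univ (min p (unitInterval.symm q)))
      ((setBernoulli Set.univ p).prod (setBernoulli Set.univ q)) := by
    rcases lt_or_ge ((p : ℝ) + q) 1 with hpq | hpq
    · rw [min_eq_left (a := p) (b := unitInterval.symm q)
        (show (p : ℝ) ≤ unitInterval.symm q by rw [unitInterval.coe_symm_eq]; linarith)]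
      exact hasLaw_servedPositions_of_add_lt_one p q hpq
    · rw [min_eq_right (a := p) (b := unitInterval.symm q)
        (show (unitInterval.symm q : ℝ) ≤ p by rw [unitInterval.coe_symm_eq]; linarith)]
      exact hasLaw_servedPositions_of_one_le_add p q hpq
  refine (hlaw.fun_comp (hasLaw_prodMk hS hT hST)).congr ?_
  filter_upwards [hx] with ω h
  exact particlePositions_eq_of_collapsesTo h

end LineLaw

theorem mainTheorem4 {Ω : Type*} [MeasurableSpace Ω] (P : Measure Ω) [IsProbabilityMeasure P] :
    (∀ (N : ℕ) [NeZero N] (a b : ℕ), a + b ≤ N →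
      ∀ (S T : Ω → Set (ZMod N)) (x : Ω → ZMod N → Site),
        HasLaw S (uniformOn {A : Set (ZMod N) | A.ncard = a}) P →
        HasLaw T (uniformOn {B : Set (ZMod N) | B.ncard = b}) P →
        IndepFun S T P →
        (∀ᵐ ω ∂P, CollapsesTo (S ω) (T ω) (x ω)) →
        HasLaw (fun ω => particlePositions (x ω))
          (uniformOn {A : Set (ZMod N) | A.ncard = a}) P) ∧
    (∀ (p q : unitInterval) (S T : Ω → Set ℤ) (x : Ω → ℤ → Site),
        HasLaw S (setBernoulli Set.univ p) P →
        HasLaw T (setBernoulli Set.univ q) P →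
        IndepFun S T P →
        (∀ᵐ ω ∂P, CollapsesTo (S ω) (T ω) (x ω)) →
        HasLaw (fun ω => particlePositions (x ω))
          (setBernoulli Set.univ (min p (unitInterval.symm q))) P) :=
  ⟨fun N _ a b hab S T x hS hT hST hx =>
      hasLaw_particlePositions_cycle P N a b hab S T x hS hT hST hx,
    fun p q S T x hS hT hST hx => hasLaw_particlePositions_line P p q S T x hS hT hST hx⟩
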